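/- Let $n\ge 2$ and $r\ge 0$ be integers. **Setting.** Let $D\subset\mathbb R^n$ be open, $\overline D=K_1\cup K_2$, where $K_1,K_2$ are closed polyhedral regions with disjoint interiors, triangulated by finite conforming simplicial meshes $\mathcal T_h$ (of $K_1$) and $\mathcal T_H$ (of $K_2$) whose open elements lie in $D$; the two meshes need not match. Put $\Gamma=\partial K_1\setminus\partial D$, let $h_\tau=\operatorname{diam}\tau$, and let $\rho_\tau$ be the supremum of the diameters of balls contained in $\tau$. The mesh $\mathcal T_{h,H}=\mathcal T_h\cup\mathcal T_H$ is shape regular with parameter $\sigma$ if $h_\tau\le\sigma\rho_\tau$ for all $\tau\in\mathcal T_{h,H}$. Let $\mathcal E_h$, $\mathcal E_H$ be the sets of $(n-1)$-dimensional faces of $\mathcal T_h$, $\mathcal T_H$ on $\Gamma$, and $\mathcal E_\cap=\{e_1\cap e_2: e_1\in\mathcal E_h,\ e_2\in\mathcal E_H\}$. For $e=e_1\cap e_2\in\mathcal E_\cap$ with $e_1$ a face of $\tau_1\in\mathcal T_h$ and $e_2$ a face of $\tau_2\in\mathcal T_H$, put $h_e=h_{\tau_1}$, $H_e=h_{\tau_2}$,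 $\omega_1=\frac{h_e}{h_e+H_e}$, $\omega_2=\frac{H_e}{h_e+H_e}$, and for a quantity with traces $v_1$ from $K_1$ and $v_2$ from $K_2$ put $\{v\}_\omega=\omega_1v_1+\omega_2v_2$ and $[v]=v_1-v_2$. Let $X_{h,H}=X_h\times X_H$, where $X_h,X_H$ are the Lagrange finite element spaces of continuous piecewise polynomials of degree at most $r$ over $\mathcal T_h$, $\mathcal T_H$, and let $\mathbf n$ be the unit normal on $\Gamma$ pointing out of $K_1$. For $\lambda',\Lambda'>0$, $\mathcal M(\lambda',\Lambda';D)$ is the set of $a\in[L^\infty(D)]^{n\times n}$ with $\xi\cdot a(x)\xi\ge\lambda'|\xi|^2$ and $\xi\cdot a(x)\xi\ge\frac1{\Lambda'}|a(x)\xi|^2$ for all $\xi\in\mathbb R^n$ and a.e. $x\in D$. Let $b=b_h^\varepsilon\in\mathcal M(\lambda',\Lambda';D)$ have traces on $\Gamma$ from $K_1$ and from $K_2$, that is, for $i=1,2$ and surface-a.e. $x\in\Gamma$ the averages of $b$ over $B(x,\delta)\cap K_i$ converge as $\delta\to0^+$. For $\gamma\in\mathbb R$ and $v,w\in X_{h,H}$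 define $$B_h^\varepsilon(v,w)=\sum_{i=1}^2\int_{K_i}b\nabla v\cdot\nabla w\,dx-\sum_{e\in\mathcal E_\cap}\int_e\{b\nabla v\cdot\mathbf n\}_\omega[w]\,ds-\sum_{e\in\mathcal E_\cap}\int_e\{b^T\nabla w\cdot\mathbf n\}_\omega[v]\,ds+\sum_{e\in\mathcal E_\cap}\int_e\frac{\gamma}{H_e+h_e}[v][w]\,ds,$$ $$|||v|||=\Big(\sum_{i=1}^2\|\nabla v\|_{L^2(K_i)}^2+\sum_{e\in\mathcal E_\cap}\frac{\gamma}{H_e+h_e}\|[v]\|_{L^2(e)}^2\Big)^{1/2}.$$ Consider the inverse trace inequality $$\|p\|_{L^2(e)}\le C_{\rm inv}\,h_\tau^{-1/2}\,\|p\|_{L^2(\tau)}\quad\text{for all polynomials } p \text{ of degree at most } r.\qquad(*)$$ **Statement.** (i) For every $\sigma$ there is a constant $C_{\rm inv}>0$, depending only on $n$, $r$ and $\sigma$, such that $(*)$ holds for every element $\tau$ of every mesh $\mathcal T_{h,H}$ as above that is shape regular with parameter $\sigma$, and every measurable $e\subset\partial\tau$. (ii) Let $\mathcal T_{h,H}$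 be a mesh as above, and let $C_{\rm inv}$ be any constant for which $(*)$ holds for every $\tau\in\mathcal T_{h,H}$ and every face $e$ of $\tau$ and, for any element $\tau$ with more than two faces on $\Gamma$, also for the union $e$ of these faces. If $\gamma\ge\gamma_0=8\Lambda'^2C_{\rm inv}^2/\min(1,\lambda'^2)$, then for all $v,w\in X_{h,H}$ $$|B_h^\varepsilon(v,w)|\le 2\max(1,\Lambda')\,|||v|||\,|||w|||,\qquad B_h^\varepsilon(v,v)\ge\min\big(\tfrac12,\tfrac{\lambda'}2\big)|||v|||^2 .$$ -/

import Mathlib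

open MeasureTheory Filter Topology

noncomputable section

namespace NitscheHybrid

/-- The space `ℝⁿ` with its Euclidean norm. -/
abbrev Pt (n : ℕ) : Type := EuclideanSpace ℝ (Fin n)

/-- The surface measure on hypersurfaces of `ℝⁿ`: the `(n-1)`-dimensional Hausdorff measure,
normalised to agree with Lebesgue measure on hyperplanes. -/
abbrev surf (n : ℕ) : Measure (Pt n) := Measure.euclideanHausdorffMeasure (n - 1)

/-! ### Simplices and triangulations -/

/-- The closed simplex with vertex set `s`. -/
abbrev hull {n : ℕ} (s : Finset (Pt n)) : Set (Pt n) := convexHull ℝ (s : Set (Pt n))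

/-- The mesh size `h_τ = diam τ` of the simplex with vertex set `s`. -/
def meshSize {n : ℕ} (s : Finset (Pt n)) : ℝ := Metric.diam (hull s)

/-- `ρ_τ`, the supremum of the diameters of the balls contained in the simplex. -/
def ballDiam {n : ℕ} (s : Finset (Pt n)) : ℝ :=
  sSup {d : ℝ | 0 ≤ d ∧ ∃ c : Pt n, Metric.closedBall c (d / 2) ⊆ hull s}

/-- The unit normal on the facet `f` of the simplex `s` that points out of `s`: the vector from
the centroid of `s` to the centroid of `f`, made orthogonal to `f` and normalised. -/
def outwardNormal {n : ℕ} (s f : Finset (Pt n)) : Pt n :=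
  let w : Pt n := ((vectorSpan ℝ (f : Set (Pt n)))ᗮ).starProjection
    (f.centroid ℝ id - s.centroid ℝ id)
  ‖w‖⁻¹ • w

/-- The elements of a triangulation of a region of `ℝⁿ`: its `n`-dimensional simplices. -/
def elements {n : ℕ} (T : Geometry.SimplicialComplex ℝ (Pt n)) : Set (Finset (Pt n)) :=
  {s | s ∈ T.faces ∧ s.card = n + 1}

/-- A domain `D ⊆ ℝⁿ` divided into two parts `K₁` and `K₂`, each with a conforming simplicial
triangulation of its own; the two triangulations need not match along the interface. -/
structure HybridMesh (n : ℕ) where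
  /-- the domain -/
  D : Set (Pt n)
  isOpen_D : IsOpen D
  /-- the triangulation `𝒯_h` of `K₁` -/
  Th : Geometry.SimplicialComplex ℝ (Pt n)
  /-- the triangulation `𝒯_H` of `K₂` -/
  TH : Geometry.SimplicialComplex ℝ (Pt n)
  finite_Th : Th.faces.Finite
  finite_TH : TH.faces.Finite
  /-- every simplex of `𝒯_h` is a face of an `n`-dimensional simplex of `𝒯_h` -/
  pure_Th : ∀ f ∈ Th.faces, ∃ s ∈ elements Th, f ⊆ s
  /-- every simplex of `𝒯_H` is a face of an `n`-dimensional simplex of `𝒯_H` -/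
  pure_TH : ∀ f ∈ TH.faces, ∃ s ∈ elements TH, f ⊆ s
  /-- the (open) elements lie in `D` -/
  interior_subset : ∀ s ∈ elements Th ∪ elements TH, interior (hull s) ⊆ D
  /-- the elements cover `D` -/
  cover : closure D = Th.space ∪ TH.space
  /-- `K₁` and `K₂` do not overlap -/
  disjoint : Disjoint (interior Th.space) (interior TH.space)

namespace HybridMesh

variable {n : ℕ} (M : HybridMesh n)

/-- The closed region `K₁`. -/
def K₁ : Set (Pt n) := M.Th.space

/-- The region `K₂ = D \ K₁`, here with its boundary, that is, up to a null set. -/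
def K₂ : Set (Pt n) := M.TH.space

/-- The interface `Γ = ∂K₁ \ ∂D`. -/
def Γ : Set (Pt n) := frontier M.K₁ \ frontier M.D

/-- All elements of `𝒯_{h,H} = 𝒯_h ∪ 𝒯_H`. -/
def allElements : Set (Finset (Pt n)) := elements M.Th ∪ elements M.TH

/-- Shape regularity with chunkiness parameter `σ`: `h_τ ≤ σ ρ_τ` for all elements `τ`. -/
def ShapeRegular (σ : ℝ) : Prop := ∀ s ∈ M.allElements, meshSize s ≤ σ * ballDiam s

/-- The pairs `(τ, e)` of an element `τ` of `T` and an `(n-1)`-dimensional face `e` of `τ` that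
lies on `Γ` (up to a set of surface measure zero, since `Γ` does not contain its end points
on `∂D`). -/
def facetSet (T : Geometry.SimplicialComplex ℝ (Pt n)) : Set (Finset (Pt n) × Finset (Pt n)) :=
  {q | q.1 ∈ elements T ∧ q.2 ⊆ q.1 ∧ q.2.card = n ∧ surf n (hull q.2 \ M.Γ) = 0}

theorem facetSet_finite {T : Geometry.SimplicialComplex ℝ (Pt n)} (hT : T.faces.Finite) :
    (M.facetSet T).Finite := by
  have h : (⋃ s ∈ T.faces, (fun f => (s, f)) '' (s.powerset : Set (Finset (Pt n)))).Finite :=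
    hT.biUnion fun s _ => (Finset.finite_toSet _).image _
  refine h.subset ?_
  rintro ⟨s, f⟩ ⟨hs, hf, -, -⟩
  simp only [Set.mem_iUnion]
  exact ⟨s, hs.1, f, by simpa using hf, rfl⟩

/-- `ℰ_h`: the faces of `𝒯_h` on `Γ`, each one with the element it belongs to. -/
def Eh : Finset (Finset (Pt n) × Finset (Pt n)) := (M.facetSet_finite M.finite_Th).toFinset

/-- `ℰ_H`: the faces of `𝒯_H` on `Γ`, each one with the element it belongs to. -/
def EH : Finset (Finset (Pt n) × Finset (Pt n)) := (M.facetSet_finite M.finite_TH).toFinset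

end HybridMesh

/-- The intersection `e ∩ E` of a face `e` of `𝒯_h` and a face `E` of `𝒯_H`. The members of `ℰ_∩`
are these sets for `(p, q) ∈ ℰ_h × ℰ_H`; those of surface measure zero do not contribute to any
integral. -/
def cap {n : ℕ} (p q : Finset (Pt n) × Finset (Pt n)) : Set (Pt n) := hull p.2 ∩ hull q.2

/-! ### Finite element spaces and the inverse trace inequality -/

/-- The Lagrange finite element space of degree `r` over `T`: continuous functions on the
triangulated region that are on each element a polynomial of total degree at most `r`.
(Their values outside the region are irrelevant.) -/
def FESpace {n : ℕ} (r : ℕ) (T : Geometry.SimplicialComplex ℝ (Pt n)) : Set (Pt n → ℝ) :=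
  {v | ContinuousOn v T.space ∧ ∀ s ∈ elements T, ∃ p : MvPolynomial (Fin n) ℝ,
    p.totalDegree ≤ r ∧ ∀ x ∈ hull s, v x = MvPolynomial.eval (fun i => x i) p}

/-- The `L²` norm of `v` on the set `S`, with respect to the measure `μ`. -/
def l2Norm {n : ℕ} (μ : Measure (Pt n)) (S : Set (Pt n)) (v : Pt n → ℝ) : ℝ :=
  √(∫ x in S, (v x) ^ 2 ∂μ)

/-- `‖v‖_{0,e} ≤ C h_τ^{-1/2} ‖v‖_{0,τ}` for all polynomials `v` of degree at most `r`, where `τ` is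
the simplex with vertex set `s`. -/
def TraceIneq {n : ℕ} (r : ℕ) (C : ℝ) (s : Finset (Pt n)) (e : Set (Pt n)) : Prop :=
  ∀ p : MvPolynomial (Fin n) ℝ, p.totalDegree ≤ r →
    l2Norm (surf n) e (fun x => MvPolynomial.eval (fun i => x i) p) ≤
      C * (√(meshSize s))⁻¹ * l2Norm volume (hull s) (fun x => MvPolynomial.eval (fun i => x i) p)

/-- The part of the boundary of the element `s` that consists of those faces of `s` that are
listed in `F`. -/
def facetUnion {n : ℕ} (F : Finset (Finset (Pt n) × Finset (Pt n))) (s : Finset (Pt n)) :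
    Set (Pt n) := ⋃ f ∈ {f | (s, f) ∈ F}, hull f

/-- `C` is a constant in the inverse trace inequality on the mesh `M` for polynomials of degree at
most `r`: the inequality holds for `e` any face of any element `τ`. On the rare elements with more
than two faces on the interface, it is also required for the part `e` of `∂τ` made up of all
these faces together. -/
def HybridMesh.IsTraceConst {n : ℕ} (M : HybridMesh n) (r : ℕ) (C : ℝ) : Prop :=
  (∀ s ∈ M.allElements, ∀ f ⊆ s, f.card = n → TraceIneq r C s (hull f)) ∧
  (∀ F ∈ ({M.Eh, M.EH} : Set (Finset (Finset (Pt n) × Finset (Pt n)))), ∀ s ∈ M.allElements,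
    2 < Set.ncard {f | (s, f) ∈ F} → TraceIneq r C s (facetUnion F s))

/-! ### Coefficients -/

/-- The class `ℳ(lam, Lam; D)`. A matrix is identified with the linear map on `ℝⁿ` it defines. -/
def CoeffClass {n : ℕ} (lam Lam : ℝ) (D : Set (Pt n)) : Set (Pt n → (Pt n →L[ℝ] Pt n)) :=
  {a | MemLp a ⊤ (volume.restrict D) ∧
    ∀ᵐ x ∂(volume.restrict D), ∀ ξ : Pt n,
      lam * ‖ξ‖ ^ 2 ≤ inner ℝ ξ (a x ξ) ∧ 1 / Lam * ‖a x ξ‖ ^ 2 ≤ inner ℝ ξ (a x ξ)}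

/-- `β` is the trace on `G` of the coefficient `b`, taken from the side of `K`: at almost every
point `x` of `G`, `β x` is the limit of the averages of `b` over the sets `B(x, δ) ∩ K`. -/
def IsTraceOn {n : ℕ} (K G : Set (Pt n)) (b β : Pt n → (Pt n →L[ℝ] Pt n)) : Prop :=
  ∀ᵐ x ∂((surf n).restrict G),
    Tendsto (fun δ : ℝ => ⨍ y in Metric.ball x δ ∩ K, b y) (𝓝[>] 0) (𝓝 (β x))

/-! ### The bilinear form and the norm -/

namespace HybridMesh

variable {n : ℕ} (M : HybridMesh n)

/-- The weighted average on a piece of the interface between the element `s` of `𝒯_h` and the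
element `t` of `𝒯_H`, with weights `h_e / (h_e + H_e)` and `H_e / (h_e + H_e)`. -/
def wavg (s t : Finset (Pt n)) (y₁ y₂ : ℝ) : ℝ :=
  meshSize s / (meshSize s + meshSize t) * y₁ + meshSize t / (meshSize s + meshSize t) * y₂

/-- The flux term `∑_{e ∈ ℰ_∩} ∫_e {a ∇v · n}_ω [w] ds`. Here `a₁`, `a₂` are the traces of `a` on
`Γ` from `K₁` and `K₂`; the trace of the gradient of a piecewise polynomial from the element `s`
is its derivative at the boundary point within `s`; `n` is the unit normal on `Γ` out of `K₁`. -/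
def fluxTerm (a₁ a₂ : Pt n → (Pt n →L[ℝ] Pt n)) (v w : (Pt n → ℝ) × (Pt n → ℝ)) : ℝ :=
  ∑ p ∈ M.Eh, ∑ q ∈ M.EH, ∫ x in cap p q,
    wavg p.1 q.1
      (inner ℝ (a₁ x (gradientWithin v.1 (hull p.1) x)) (outwardNormal p.1 p.2))
      (inner ℝ (a₂ x (gradientWithin v.2 (hull q.1) x)) (outwardNormal p.1 p.2))
    * (w.1 x - w.2 x) ∂(surf n)

/-- The penalty term `∑_{e ∈ ℰ_∩} ∫_e γ / (H_e + h_e) [v] [w] ds`. -/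
def penaltyTerm (γ : ℝ) (v w : (Pt n → ℝ) × (Pt n → ℝ)) : ℝ :=
  ∑ p ∈ M.Eh, ∑ q ∈ M.EH, ∫ x in cap p q,
    γ / (meshSize q.1 + meshSize p.1) * (v.1 x - v.2 x) * (w.1 x - w.2 x) ∂(surf n)

/-- The bilinear form of the Nitsche method for the coefficient `b` with traces `β₁`, `β₂` on the
interface. -/
def bilin (b β₁ β₂ : Pt n → (Pt n →L[ℝ] Pt n)) (γ : ℝ) (v w : (Pt n → ℝ) × (Pt n → ℝ)) : ℝ :=
  (∫ x in M.K₁, inner ℝ (b x (gradient v.1 x)) (gradient w.1 x))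
    + (∫ x in M.K₂, inner ℝ (b x (gradient v.2 x)) (gradient w.2 x))
    - M.fluxTerm β₁ β₂ v w
    - M.fluxTerm (fun x => (β₁ x).adjoint) (fun x => (β₂ x).adjoint) w v
    + M.penaltyTerm γ v w

/-- The broken energy norm. -/
def brokenNorm (γ : ℝ) (v : (Pt n → ℝ) × (Pt n → ℝ)) : ℝ :=
  √((∫ x in M.K₁, ‖gradient v.1 x‖ ^ 2) + (∫ x in M.K₂, ‖gradient v.2 x‖ ^ 2)
    + ∑ p ∈ M.Eh, ∑ q ∈ M.EH, γ / (meshSize q.1 + meshSize p.1)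
        * l2Norm (surf n) (cap p q) (fun x => v.1 x - v.2 x) ^ 2)

end HybridMesh

end NitscheHybrid

end

/-! The inverse trace inequality is a scaling argument. On polynomials of degree at most r all norms
are equivalent, so the maximum over the unit ball is controlled by the L² norm over a concentric
ball of radius δ (`exists_sq_le_integral_closedBall`). A shape regular simplex of diameter h
contains a ball of radius δh with δ depending only on σ, and lies in the ball of radius h about the
same centre. Rescaling bounds p² on τ by a multiple of h⁻ⁿ ∫_τ p². Since ∂τ consists of n + 1 facets
of diameter at most h, its surface measure is at most a multiple of hⁿ⁻¹, and integration over e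
leaves the factor h⁻¹ (`exists_traceIneq`).

For the form, write G for the squared broken gradient norm and J for the sum of the squared jumps
divided by h + H. Everything rests on the flux bound Λ √(2C²G) √J (`abs_fluxTerm_le`), which has
three ingredients. The matrices admitted by the class form a closed convex set, so averages of b and
their limits, the traces, stay in it and have norm at most Λ (`ae_trace_mem_coeffSet`). The weights
h/(h+H) and H/(h+H) split the flux on each piece into the gradients, weighted by h and H, and the
jump, weighted by 1/(h+H) (`weighted_mul_le`). The weighted gradients on Γ sum to at most 2C²G: an
element with at most two facets on Γ pays C² for each, and an element with more pays C² once for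
their union (`sum_facets_le`). The summation needs the listed facets to overlap only in null sets,
which holds because a facet shared by two elements of one mesh lies, up to its boundary, in the
interior of its region (`hull_subset_interior_union`).

With m = min(1, λ), the threshold on γ turns the flux bound into (m/2) √G √(γJ)
(`mul_sqrt_le_of_penalty`). Boundedness and coercivity are then inequalities between the numbers √G
and √(γJ) (`form_le_of_bounds`, `le_form_of_bounds`). -/

noncomputable section

namespace NitscheHybrid

variable {n : ℕ}

/-! ### Simplices and their barycentric coordinates -/

/-- The affine basis of `ℝⁿ` formed by the vertices of an `n`-simplex. -/
def vertexBasis (s : Finset (Pt n)) (hs : AffineIndependent ℝ ((↑) : s → Pt n))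
    (hc : s.card = n + 1) : AffineBasis s ℝ (Pt n) :=
  ⟨(↑), hs, by
    rw [hs.affineSpan_eq_top_iff_card_eq_finrank_add_one]
    simpa using hc⟩

section Basis

variable {s : Finset (Pt n)} (hs : AffineIndependent ℝ ((↑) : s → Pt n)) (hc : s.card = n + 1)

theorem vertexBasis_apply (i : s) : vertexBasis s hs hc i = i := rfl

theorem range_vertexBasis : Set.range (vertexBasis s hs hc) = (s : Set (Pt n)) :=
  Subtype.range_coe

theorem mem_hull_iff {x : Pt n} :
    x ∈ hull s ↔ ∀ i, 0 ≤ (vertexBasis s hs hc).coord i x := by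
  rw [hull, ← range_vertexBasis hs hc, AffineBasis.convexHull_eq_nonneg_coord]
  rfl

theorem mem_interior_hull_iff {x : Pt n} :
    x ∈ interior (hull s) ↔ ∀ i, 0 < (vertexBasis s hs hc).coord i x := by
  rw [hull, ← range_vertexBasis hs hc, AffineBasis.interior_convexHull]
  rfl

include hs hc in
theorem interior_hull_nonempty : (interior (hull s)).Nonempty := by
  rw [hull, interior_convexHull_nonempty_iff_affineSpan_eq_top, ← range_vertexBasis hs hc]
  exact (vertexBasis s hs hc).tot

theorem sum_coord_smul (x : Pt n) :
    ∑ i : s, (vertexBasis s hs hc).coord i x • (i : Pt n) = x :=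
  (vertexBasis s hs hc).linear_combination_coord_eq_self x

theorem coord_eq_zero_of_mem_hull {f : Finset (Pt n)} (hf : f ⊆ s) {i : s} (hi : (i : Pt n) ∉ f)
    {x : Pt n} (hx : x ∈ hull f) : (vertexBasis s hs hc).coord i x = 0 := by
  have key : hull f ⊆ ((vertexBasis s hs hc).coord i) ⁻¹' {0} := by
    refine convexHull_min ?_
      ((convex_singleton (0 : ℝ)).affine_preimage ((vertexBasis s hs hc).coord i))
    intro y hy
    have hys : y ∈ s := hf hy
    have hne : i ≠ ⟨y, hys⟩ := fun h => hi (by rw [h]; exact hy)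
    have h := (vertexBasis s hs hc).coord_apply_ne hne
    rw [vertexBasis_apply] at h
    exact h
  exact key hx

/-- The vertices outside `f` drop out of the barycentric combination of `x`, so the coordinates
themselves are the convex weights on `f`. -/
theorem mem_hull_of_coord {f : Finset (Pt n)} (hf : f ⊆ s) {x : Pt n} (hx : x ∈ hull s)
    (h0 : ∀ i : s, (i : Pt n) ∉ f → (vertexBasis s hs hc).coord i x = 0) : x ∈ hull f := by
  classical
  set b := vertexBasis s hs hc
  have hnn := (mem_hull_iff hs hc).1 hx
  rw [hull, Finset.mem_convexHull']
  refine ⟨fun y => if h : y ∈ s then b.coord ⟨y, h⟩ x else 0, ?_, ?_, ?_⟩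
  · intro y hy
    simp only [hf hy, dif_pos]
    exact hnn _
  · have h1 : ∑ y ∈ f, (if h : y ∈ s then b.coord ⟨y, h⟩ x else 0)
        = ∑ y ∈ s, (if h : y ∈ s then b.coord ⟨y, h⟩ x else 0) := by
      refine Finset.sum_subset hf fun y hy hyf => ?_
      simp only [hy, dif_pos]
      exact h0 ⟨y, hy⟩ hyf
    rw [h1, ← Finset.sum_coe_sort s]
    simpa using b.sum_coord_apply_eq_one x
  · have h1 : ∑ y ∈ f, (if h : y ∈ s then b.coord ⟨y, h⟩ x else 0) • y
        = ∑ y ∈ s, (if h : y ∈ s then b.coord ⟨y, h⟩ x else 0) • y := by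
      refine Finset.sum_subset hf fun y hy hyf => ?_
      simp only [hy, dif_pos]
      rw [h0 ⟨y, hy⟩ hyf, zero_smul]
    rw [h1, ← Finset.sum_coe_sort s]
    simpa using sum_coord_smul hs hc x

include hs hc in
-- At a boundary point some barycentric coordinate vanishes, which places the point on the facet
-- opposite to that vertex.
theorem frontier_hull_subset : frontier (hull s) ⊆ ⋃ i ∈ s, hull (s.erase i) := by
  intro x hx
  have hcl : IsClosed (hull s) := s.finite_toSet.isClosed_convexHull ℝ
  rw [hcl.frontier_eq] at hx
  obtain ⟨hx, hxi⟩ := hx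
  rw [mem_interior_hull_iff hs hc] at hxi
  push Not at hxi
  obtain ⟨i, hi⟩ := hxi
  have h0 := le_antisymm hi ((mem_hull_iff hs hc).1 hx i)
  simp only [Set.mem_iUnion]
  refine ⟨i, i.2, mem_hull_of_coord hs hc (Finset.erase_subset _ _) hx ?_⟩
  intro j hj
  have : j = i := by
    by_contra hne
    exact hj (Finset.mem_erase.2 ⟨fun h => hne (Subtype.ext h), j.2⟩)
  rw [this, h0]

include hs hc in
theorem hull_subset_frontier {f : Finset (Pt n)} (hf : f ⊂ s) :
    hull f ⊆ frontier (hull s) := by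
  intro x hx
  have hcl : IsClosed (hull s) := s.finite_toSet.isClosed_convexHull ℝ
  rw [hcl.frontier_eq]
  refine ⟨convexHull_mono (by exact_mod_cast hf.1) hx, fun hi => ?_⟩
  obtain ⟨y, hys, hyf⟩ := Finset.exists_of_ssubset hf
  have := (mem_interior_hull_iff hs hc).1 hi ⟨y, hys⟩
  rw [coord_eq_zero_of_mem_hull hs hc hf.1 (i := ⟨y, hys⟩) hyf hx] at this
  exact lt_irrefl _ this

end Basis

theorem isCompact_hull (s : Finset (Pt n)) : IsCompact (hull s) :=
  s.finite_toSet.isCompact_convexHull ℝ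

theorem measurableSet_hull (s : Finset (Pt n)) : MeasurableSet (hull s) :=
  (isCompact_hull s).isClosed.measurableSet

theorem meshSize_nonneg (s : Finset (Pt n)) : 0 ≤ meshSize s := Metric.diam_nonneg

theorem meshSize_pos {s : Finset (Pt n)} (hc : 1 < s.card) : 0 < meshSize s := by
  obtain ⟨x, hx, y, hy, hxy⟩ := Finset.one_lt_card.1 hc
  exact (dist_pos.2 hxy).trans_le (Metric.dist_le_diam_of_mem (isCompact_hull s).isBounded
    (subset_convexHull ℝ _ hx) (subset_convexHull ℝ _ hy))

/-- A common facet of two simplices of a complex lies, up to its own boundary, in the interior of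
their union. -/
theorem hull_subset_interior_union {T : Geometry.SimplicialComplex ℝ (Pt n)}
    {s t f : Finset (Pt n)} (hs : s ∈ elements T) (ht : t ∈ elements T) (hst : s ≠ t)
    (hfs : f ⊆ s) (hft : f ⊆ t) (hf : f.card = n) :
    hull f ⊆ interior (hull s ∪ hull t) ∪ ⋃ i ∈ f, hull (f.erase i) := by
  classical
  have is := T.indep hs.1
  have it := T.indep ht.1
  set b := vertexBasis s is hs.2
  set c := vertexBasis t it ht.2
  -- the vertices opposite to the common facet
  obtain ⟨a, has, haf⟩ : ∃ a ∈ s, a ∉ f := Finset.exists_mem_notMem_of_card_lt_card (by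
    rw [hs.2, hf]; omega)
  obtain ⟨d, hdt, hdf⟩ : ∃ d ∈ t, d ∉ f := Finset.exists_mem_notMem_of_card_lt_card (by
    rw [ht.2, hf]; omega)
  have hsf : s = insert a f := by
    symm
    apply Finset.eq_of_subset_of_card_le (Finset.insert_subset has hfs)
    rw [Finset.card_insert_of_notMem haf, hs.2, hf]
  have htf : t = insert d f := by
    symm
    apply Finset.eq_of_subset_of_card_le (Finset.insert_subset hdt hft)
    rw [Finset.card_insert_of_notMem hdf, ht.2, hf]
  have hint : s ∩ t = f := by
    have h1 : f ⊆ s ∩ t := Finset.subset_inter hfs hft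
    symm
    apply Finset.eq_of_subset_of_card_le h1
    by_contra hlt
    push Not at hlt
    have h2 : (s ∩ t).card ≤ s.card := Finset.card_le_card Finset.inter_subset_left
    have h3 : s ∩ t = s := Finset.eq_of_subset_of_card_le Finset.inter_subset_left (by
      rw [hs.2]; omega)
    have h4 : s ∩ t = t := Finset.eq_of_subset_of_card_le Finset.inter_subset_right (by
      rw [ht.2]; omega)
    exact hst (h3.symm.trans h4)
  set A : s := ⟨a, has⟩
  set Dd : t := ⟨d, hdt⟩
  have hcontb : ∀ i, Continuous (b.coord i) := fun i => continuous_barycentric_coord b i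
  have hcontc : ∀ i, Continuous (c.coord i) := fun i => continuous_barycentric_coord c i
  -- the coordinate functions of the opposite vertices are proportional
  have hprop : ∀ x, b.coord A x = c.coord Dd x * b.coord A d := by
    intro x
    have hlin : b.coord A x = ∑ i : t, c.coord i x * b.coord A i := by
      have h1 := c.affineCombination_coord_eq_self x
      have h2 : b.coord A (Finset.univ.affineCombination ℝ c fun i => c.coord i x)
          = ∑ i : t, c.coord i x * b.coord A i := by
        rw [Finset.map_affineCombination _ _ _ (c.sum_coord_apply_eq_one x),
          Finset.affineCombination_eq_linear_combination _ _ _ (c.sum_coord_apply_eq_one x)]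
        rfl
      rw [← h2, h1]
    -- Both coordinate functions are affine and vanish on `f`; only the vertex `d` of `t`
    -- contributes.
    rw [hlin, Finset.sum_eq_single Dd]
    · intro i _ hi
      have hif : (i : Pt n) ∈ f := by
        rcases Finset.mem_insert.1 (htf.subset i.2) with h | h
        · exact absurd (Subtype.ext h) hi
        · exact h
      rw [coord_eq_zero_of_mem_hull is hs.2 hfs (i := A) haf (subset_convexHull ℝ _ hif), mul_zero]
    · simp
  -- positivity of the coordinates of `f` near a point
  have hnear : ∀ x : Pt n, x ∈ hull f → (∀ i : s, (i : Pt n) ∈ f → 0 < b.coord i x) →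
      (∀ i : t, (i : Pt n) ∈ f → 0 < c.coord i x) →
      ∀ᶠ y in 𝓝 x, (∀ i : s, (i : Pt n) ∈ f → 0 < b.coord i y) ∧
        (∀ i : t, (i : Pt n) ∈ f → 0 < c.coord i y) := by
    intro x _ h1 h2
    refine (eventually_all.2 fun i => ?_).and (eventually_all.2 fun i => ?_)
    · by_cases hi : (i : Pt n) ∈ f
      · filter_upwards [(hcontb i).continuousAt.eventually (lt_mem_nhds (h1 i hi))] with y hy _
        exact hy
      · exact Eventually.of_forall fun y h => absurd h hi
    · by_cases hi : (i : Pt n) ∈ f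
      · filter_upwards [(hcontc i).continuousAt.eventually (lt_mem_nhds (h2 i hi))] with y hy _
        exact hy
      · exact Eventually.of_forall fun y h => absurd h hi
  have hmems : ∀ y, (∀ i : s, (i : Pt n) ∈ f → 0 < b.coord i y) → 0 ≤ b.coord A y →
      y ∈ hull s := by
    intro y h1 h2
    rw [mem_hull_iff is hs.2]
    intro i
    by_cases hi : (i : Pt n) ∈ f
    · exact (h1 i hi).le
    · have : i = A := by
        rcases Finset.mem_insert.1 (hsf.subset i.2) with h | h
        · exact Subtype.ext h
        · exact absurd h hi
      rw [this]; exact h2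
  have hmemt : ∀ y, (∀ i : t, (i : Pt n) ∈ f → 0 < c.coord i y) → 0 ≤ c.coord Dd y →
      y ∈ hull t := by
    intro y h1 h2
    rw [mem_hull_iff it ht.2]
    intro i
    by_cases hi : (i : Pt n) ∈ f
    · exact (h1 i hi).le
    · have : i = Dd := by
        rcases Finset.mem_insert.1 (htf.subset i.2) with h | h
        · exact Subtype.ext h
        · exact absurd h hi
      rw [this]; exact h2
  -- a point of `f` with a vanishing coordinate is on the boundary of `f`
  have hbdry : ∀ x, x ∈ hull f → x ∉ ⋃ i ∈ f, hull (f.erase i) →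
      (∀ i : s, (i : Pt n) ∈ f → 0 < b.coord i x) ∧
      (∀ i : t, (i : Pt n) ∈ f → 0 < c.coord i x) := by
    intro x hx hxn
    simp only [Set.mem_iUnion, not_exists] at hxn
    constructor
    · intro i hi
      refine lt_of_le_of_ne ((mem_hull_iff is hs.2).1
        (convexHull_mono (by exact_mod_cast hfs) hx) i) fun h0 => ?_
      refine hxn i hi (mem_hull_of_coord is hs.2 ((Finset.erase_subset _ _).trans hfs)
        (convexHull_mono (by exact_mod_cast hfs) hx) ?_)
      intro j hj
      by_cases hjf : (j : Pt n) ∈ f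
      · have : j = i := by
          by_contra hne
          exact hj (Finset.mem_erase.2 ⟨fun h => hne (Subtype.ext h), hjf⟩)
        rw [this]; exact h0.symm
      · exact coord_eq_zero_of_mem_hull is hs.2 hfs hjf hx
    · intro i hi
      refine lt_of_le_of_ne ((mem_hull_iff it ht.2).1
        (convexHull_mono (by exact_mod_cast hft) hx) i) fun h0 => ?_
      refine hxn i hi (mem_hull_of_coord it ht.2 ((Finset.erase_subset _ _).trans hft)
        (convexHull_mono (by exact_mod_cast hft) hx) ?_)
      intro j hj
      by_cases hjf : (j : Pt n) ∈ f
      · have : j = i := by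
          by_contra hne
          exact hj (Finset.mem_erase.2 ⟨fun h => hne (Subtype.ext h), hjf⟩)
        rw [this]; exact h0.symm
      · exact coord_eq_zero_of_mem_hull it ht.2 hft hjf hx
  intro x hx
  by_cases hxb : x ∈ ⋃ i ∈ f, hull (f.erase i)
  · exact Or.inr hxb
  left
  obtain ⟨hxs, hxt⟩ := hbdry x hx hxb
  have hev := hnear x hx hxs hxt
  have hx0 : b.coord A x = 0 := coord_eq_zero_of_mem_hull is hs.2 hfs (i := A) haf hx
  -- the opposite vertices are on different sides
  have hneg : b.coord A d ≤ 0 := by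
    by_contra hpos
    push Not at hpos
    -- If `d` were on the same side as `a`, a point slightly off `x` towards `a` would lie in both
    -- simplices, hence in `hull f`, although its coordinate at `a` is positive.
    have hline : Tendsto (fun ε : ℝ => AffineMap.lineMap x a ε) (𝓝[>] 0) (𝓝 x) := by
      have : Continuous (fun ε : ℝ => AffineMap.lineMap x a ε) := by fun_prop
      have h := this.tendsto 0
      simp only [AffineMap.lineMap_apply_zero] at h
      exact h.mono_left nhdsWithin_le_nhds
    obtain ⟨ε, hε, hε0⟩ := ((hline.eventually hev).and self_mem_nhdsWithin).exists
    set y := AffineMap.lineMap x a ε with hy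
    have hε0' : 0 < ε := hε0
    have hyA : b.coord A y = ε := by
      have h1 : b.coord A a = 1 := b.coord_apply_eq A
      rw [hy, AffineMap.apply_lineMap, hx0, h1]
      simp [AffineMap.lineMap_apply]
    have hys : y ∈ hull s := hmems y hε.1 (by rw [hyA]; exact hε0'.le)
    have hyD : 0 ≤ c.coord Dd y := by
      have := hprop y
      rw [hyA] at this
      by_contra hlt
      push Not at hlt
      nlinarith
    have hyt : y ∈ hull t := hmemt y hε.2 hyD
    have hyf : y ∈ hull f := by
      have := T.inter_subset_convexHull hs.1 ht.1 ⟨hys, hyt⟩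
      rwa [← Finset.coe_inter, hint] at this
    have := coord_eq_zero_of_mem_hull is hs.2 hfs (i := A) haf hyf
    change b.coord A y = 0 at this
    rw [hyA] at this
    exact hε0'.ne' this
  rw [mem_interior_iff_mem_nhds]
  -- Near `x` only the sign of the coordinate at `a` matters: if it is nonnegative the point is in
  -- `s`, and if it is negative, proportionality with a nonpositive factor makes the coordinate at
  -- `d` nonnegative.
  filter_upwards [hev] with y hy
  rcases le_or_gt 0 (b.coord A y) with h | h
  · exact Or.inl (hmems y hy.1 h)
  · refine Or.inr (hmemt y hy.2 ?_)
    have := hprop y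
    by_contra hlt
    push Not at hlt
    nlinarith

/-! ### Surface measure of simplices -/

/-- The affine span of `f` is an isometric copy of `Pt (n - 1)`, in which the hull fits into a ball
of radius `R` about a vertex; the normalised Hausdorff measure is preserved by the isometry. Leaving
`R` free allows the diameter of the whole simplex to be inserted for a facet. -/
theorem surf_hull_le {f : Finset (Pt n)} (hind : AffineIndependent ℝ ((↑) : f → Pt n))
    (hf : f.card = n) (hn : 0 < n) {R : ℝ} (hR : ∀ x ∈ hull f, ∀ y ∈ hull f, dist x y ≤ R) :
    surf n (hull f) ≤
      ENNReal.ofReal (R ^ (n - 1)) * volume (Metric.closedBall (0 : Pt (n - 1)) 1) := by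
  obtain ⟨v, hv⟩ : f.Nonempty := Finset.card_pos.1 (by omega)
  have hvf : v ∈ hull f := subset_convexHull ℝ _ hv
  have hR0 : 0 ≤ R := dist_nonneg.trans (hR v hvf v hvf)
  set W := vectorSpan ℝ (f : Set (Pt n)) with hW
  have hfr : Module.finrank ℝ W = n - 1 := by
    have h := hind.finrank_vectorSpan (n := n - 1) (by rw [Fintype.card_coe]; omega)
    rwa [Subtype.range_coe_subtype] at h
  let e : W ≃ₗᵢ[ℝ] Pt (n - 1) := ((stdOrthonormalBasis ℝ W).reindex (finCongr hfr)).repr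
  let g : Pt (n - 1) → Pt n := fun y => (e.symm y : Pt n) + v
  have hg : Isometry g := by
    refine Isometry.of_dist_eq fun y z => ?_
    simp only [g, dist_add_right]
    rw [← e.symm.dist_map y z]
    rfl
  have hsub : hull f ⊆ g '' Metric.closedBall 0 R := by
    intro x hx
    have hxW : x - v ∈ W := by
      rw [hW, ← direction_affineSpan]
      exact AffineSubspace.vsub_mem_direction (convexHull_subset_affineSpan _ hx)
        (subset_affineSpan ℝ _ hv)
    refine ⟨e ⟨x - v, hxW⟩, ?_, ?_⟩
    · rw [mem_closedBall_zero_iff, e.norm_map]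
      have := hR x hx v hvf
      rwa [dist_eq_norm] at this
    · simp [g]
  calc surf n (hull f) ≤ surf n (g '' Metric.closedBall 0 R) := measure_mono hsub
    _ = volume (Metric.closedBall (0 : Pt (n - 1)) R) := by
        rw [hg.euclideanHausdorffMeasure_image, EuclideanSpace.euclideanHausdorffMeasure_eq_volume]
    _ = _ := by
        rw [Measure.addHaar_closedBall' _ _ hR0, finrank_euclideanSpace_fin]

theorem surf_hull_lt_top {f : Finset (Pt n)} (hind : AffineIndependent ℝ ((↑) : f → Pt n))
    (hf : f.card = n) (hn : 0 < n) : surf n (hull f) < ⊤ := by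
  refine (surf_hull_le hind hf hn (R := meshSize f) fun x hx y hy =>
    Metric.dist_le_diam_of_mem (isCompact_hull f).isBounded hx hy).trans_lt ?_
  exact ENNReal.mul_lt_top ENNReal.ofReal_lt_top measure_closedBall_lt_top

/-- Fewer than `n` points span a flat of dimension below `n - 1`, so the Hausdorff dimension of the
hull is too small. -/
theorem surf_hull_eq_zero {f : Finset (Pt n)} (hf : f.card < n) : surf n (hull f) = 0 := by
  rcases f.eq_empty_or_nonempty with rfl | hne
  · simp [hull]
  have hdim : dimH (hull f) < ((n - 1 : ℕ) : NNReal) := by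
    rw [Real.Convex.dimH_eq_finrank_vectorSpan (convex_convexHull ℝ _)
      (hne.to_set.convexHull)]
    have h1 : vectorSpan ℝ (hull f) = vectorSpan ℝ (f : Set (Pt n)) := by
      rw [← direction_affineSpan, ← direction_affineSpan, affineSpan_convexHull]
    have hpos := hne.card_pos
    have h2 : Module.finrank ℝ (vectorSpan ℝ (f : Set (Pt n))) ≤ f.card - 1 := by
      have h := finrank_vectorSpan_range_le ℝ ((↑) : f → Pt n) (n := f.card - 1)
        (by rw [Fintype.card_coe]; omega)
      rwa [Subtype.range_coe_subtype] at h
    rw [h1]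
    exact_mod_cast (show Module.finrank ℝ (vectorSpan ℝ (f : Set (Pt n))) < n - 1 by omega)
  have := hausdorffMeasure_of_dimH_lt hdim
  rw [surf, Measure.euclideanHausdorffMeasure_def, Measure.smul_apply]
  simp only [NNReal.coe_natCast] at this
  rw [this, smul_zero]

/-- In a simplicial complex two faces meet inside the hull of their common vertices, of which there
are fewer than `n`. -/
theorem surf_hull_inter_eq_zero {T : Geometry.SimplicialComplex ℝ (Pt n)} {f g : Finset (Pt n)}
    (hf : f ∈ T.faces) (hg : g ∈ T.faces) (hfn : f.card = n) (hgn : g.card = n) (hne : f ≠ g) :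
    surf n (hull f ∩ hull g) = 0 := by
  classical
  have hsub : hull f ∩ hull g ⊆ hull (f ∩ g) := by
    have := T.inter_subset_convexHull hf hg
    rwa [← Finset.coe_inter] at this
  refine measure_mono_null hsub (surf_hull_eq_zero ?_)
  by_contra hlt
  push Not at hlt
  have h1 : f ∩ g = f := Finset.eq_of_subset_of_card_le Finset.inter_subset_left (by omega)
  have h2 : f ∩ g = g := Finset.eq_of_subset_of_card_le Finset.inter_subset_right (by omega)
  exact hne (h1.symm.trans h2)

theorem volume_hull_inter_eq_zero {T : Geometry.SimplicialComplex ℝ (Pt n)} {s t : Finset (Pt n)}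
    (hs : s ∈ elements T) (ht : t ∈ elements T) (hne : s ≠ t) :
    volume (hull s ∩ hull t) = 0 := by
  classical
  have hsub : hull s ∩ hull t ⊆ hull (s ∩ t) := by
    have := T.inter_subset_convexHull hs.1 ht.1
    rwa [← Finset.coe_inter] at this
  have hss : s ∩ t ⊂ s := by
    refine Finset.ssubset_iff_subset_ne.2 ⟨Finset.inter_subset_left, fun h => hne ?_⟩
    have h1 : s ⊆ t := Finset.inter_eq_left.1 h
    exact Finset.eq_of_subset_of_card_le h1 (by rw [hs.2, ht.2])
  exact measure_mono_null (hsub.trans (hull_subset_frontier (T.indep hs.1) hs.2 hss))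
    (Convex.addHaar_frontier volume (convex_convexHull ℝ _))

/-- A facet shared by two elements of `T` meets a set that avoids the interior of the triangulated
region only in a null set. -/
theorem surf_shared_facet {T : Geometry.SimplicialComplex ℝ (Pt n)} {s t f : Finset (Pt n)}
    (hs : s ∈ elements T) (ht : t ∈ elements T) (hst : s ≠ t) (hfs : f ⊆ s) (hft : f ⊆ t)
    (hf : f.card = n) {G : Set (Pt n)} (hG : Disjoint (interior T.space) G) :
    surf n (hull f ∩ G) = 0 := by
  classical
  have hsub : hull f ∩ G ⊆ ⋃ i ∈ f, hull (f.erase i) := by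
    rintro x ⟨hx, hxG⟩
    rcases hull_subset_interior_union hs ht hst hfs hft hf hx with h | h
    · refine absurd hxG (Set.disjoint_left.1 hG (interior_mono ?_ h))
      exact Set.union_subset (T.convexHull_subset_space hs.1) (T.convexHull_subset_space ht.1)
    · exact h
  refine measure_mono_null hsub ((measure_biUnion_null_iff f.countable_toSet).2 fun i hi => ?_)
  refine surf_hull_eq_zero ?_
  have := Finset.card_erase_lt_of_mem hi
  omega

/-! ### Polynomial functions on `ℝⁿ` -/

/-- The function on `ℝⁿ` defined by the polynomial `p`. -/
abbrev polyFun (p : MvPolynomial (Fin n) ℝ) : Pt n → ℝ :=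
  fun x => MvPolynomial.eval (fun i => x i) p

/-- The gradient of the polynomial `p`. -/
def polyGrad (p : MvPolynomial (Fin n) ℝ) (x : Pt n) : Pt n :=
  WithLp.toLp 2 fun i => polyFun (MvPolynomial.pderiv i p) x

theorem continuous_polyFun (p : MvPolynomial (Fin n) ℝ) : Continuous (polyFun p) :=
  (MvPolynomial.continuous_eval p).comp (by fun_prop)

theorem continuous_polyGrad (p : MvPolynomial (Fin n) ℝ) : Continuous (polyGrad p) :=
  (PiLp.continuous_toLp 2 _).comp (continuous_pi fun _ => continuous_polyFun _)

theorem norm_sq_polyGrad (p : MvPolynomial (Fin n) ℝ) (x : Pt n) :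
    ‖polyGrad p x‖ ^ 2 = ∑ i, polyFun (MvPolynomial.pderiv i p) x ^ 2 := by
  simp [polyGrad, EuclideanSpace.norm_sq_eq]

theorem hasFDerivAt_polyFun (p : MvPolynomial (Fin n) ℝ) (x : Pt n) :
    HasFDerivAt (polyFun p)
      (∑ i, polyFun (MvPolynomial.pderiv i p) x • (EuclideanSpace.proj i : Pt n →L[ℝ] ℝ)) x := by
  classical
  induction p using MvPolynomial.induction_on with
  | C a =>
    have h : polyFun (MvPolynomial.C a) = fun _ : Pt n => a := by ext; simp
    rw [h]
    exact (hasFDerivAt_const a x).congr_fderiv (by ext; simp)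
  | add p q hp hq =>
    have h : polyFun (p + q) = polyFun p + polyFun q := by ext; simp
    rw [h]
    exact (hp.add hq).congr_fderiv (by simp [add_smul, Finset.sum_add_distrib])
  | mul_X p i hp =>
    have h : polyFun (p * MvPolynomial.X i) = polyFun p * fun y : Pt n => y i := by ext; simp
    have h2 : HasFDerivAt (fun y : Pt n => y i) (EuclideanSpace.proj i : Pt n →L[ℝ] ℝ) x :=
      (EuclideanSpace.proj i : Pt n →L[ℝ] ℝ).hasFDerivAt
    rw [h]
    refine (hp.mul h2).congr_fderiv ?_
    simp only [polyFun, map_mul, MvPolynomial.eval_X, MvPolynomial.pderiv_mul, map_add,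
      MvPolynomial.pderiv_X, add_smul, Finset.sum_add_distrib]
    rw [add_comm]
    congr 1
    · rw [Finset.smul_sum]
      refine Finset.sum_congr rfl fun j _ => ?_
      rw [smul_smul, mul_comm]
    · symm
      rw [Finset.sum_eq_single i]
      · simp
      · intro j _ hj
        simp [hj.symm]
      · simp

theorem hasGradientAt_polyFun (p : MvPolynomial (Fin n) ℝ) (x : Pt n) :
    HasGradientAt (polyFun p) (polyGrad p x) x := by
  rw [hasGradientAt_iff_hasFDerivAt]
  refine (hasFDerivAt_polyFun p x).congr_fderiv ?_
  ext y
  simp [polyGrad, PiLp.inner_apply, mul_comm]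

/-- The bound `r` is crude but sufficient: it admits the partial derivatives to the trace inequality
in degree at most `r`. -/
theorem totalDegree_pderiv_le_of_le {p : MvPolynomial (Fin n) ℝ} {r : ℕ} (hp : p.totalDegree ≤ r)
    (i : Fin n) : (MvPolynomial.pderiv i p).totalDegree ≤ r := by
  classical
  rw [p.as_sum, map_sum]
  refine (MvPolynomial.totalDegree_finsetSum _ _).trans (Finset.sup_le fun m hm => ?_)
  rw [MvPolynomial.pderiv_monomial]
  refine (MvPolynomial.totalDegree_monomial_le _ _).trans ?_
  refine le_trans ?_ ((MvPolynomial.le_totalDegree hm).trans hp)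
  have hle : m - Finsupp.single i 1 ≤ m := tsub_le_self
  rw [Finsupp.sum_fintype _ _ (by simp), Finsupp.sum_fintype _ _ (by simp)]
  exact Finset.sum_le_sum fun j _ => hle j

/-- Substitution of affine polynomials for the variables does not raise the degree. This transports
a simplex to unit size. -/
theorem exists_polyFun_comp_affine {p : MvPolynomial (Fin n) ℝ} {r : ℕ} (hp : p.totalDegree ≤ r)
    (c : Pt n) (h : ℝ) : ∃ q : MvPolynomial (Fin n) ℝ, q.totalDegree ≤ r ∧
      ∀ y, polyFun q y = polyFun p (c + h • y) := by
  classical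
  set l : Fin n → MvPolynomial (Fin n) ℝ := fun i =>
    MvPolynomial.C (c i) + MvPolynomial.C h * MvPolynomial.X i with hl
  have hdeg : ∀ i, (l i).totalDegree ≤ 1 := by
    intro i
    refine (MvPolynomial.totalDegree_add _ _).trans (max_le (by simp) ?_)
    refine (MvPolynomial.totalDegree_mul _ _).trans ?_
    simp
  refine ⟨MvPolynomial.bind₁ l p, ?_, ?_⟩
  · rw [MvPolynomial.bind₁, MvPolynomial.aeval_def, MvPolynomial.eval₂_eq']
    refine (MvPolynomial.totalDegree_finsetSum _ _).trans (Finset.sup_le fun m hm => ?_)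
    refine (MvPolynomial.totalDegree_mul _ _).trans ?_
    rw [MvPolynomial.algebraMap_eq, MvPolynomial.totalDegree_C, zero_add]
    refine (MvPolynomial.totalDegree_finsetProd _ _).trans ?_
    refine le_trans ?_ ((MvPolynomial.le_totalDegree hm).trans hp)
    rw [Finsupp.sum_fintype _ _ (by simp)]
    refine Finset.sum_le_sum fun j _ => (MvPolynomial.totalDegree_pow _ _).trans ?_
    exact (Nat.mul_le_mul_left _ (hdeg j)).trans (by simp)
  · intro y
    have h1 : polyFun (MvPolynomial.bind₁ l p) y
        = MvPolynomial.eval (fun i => polyFun (l i) y) p := by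
      rw [polyFun, MvPolynomial.eval, MvPolynomial.eval₂Hom_bind₁]
      rfl
    rw [h1]
    simp [hl, polyFun]

theorem polynomial_eq_zero_of_ball {p : MvPolynomial (Fin n) ℝ} {δ : ℝ} (hδ : 0 < δ)
    (h : ∀ x ∈ Metric.ball (0 : Pt n) δ, polyFun p x = 0) : p = 0 := by
  -- The ball contains the cube [0, ε]ⁿ, whose diagonal is ε√n, and a polynomial vanishing on a
  -- product of infinite sets is zero.
  have hcube : ∀ᶠ ε : ℝ in 𝓝[>] 0, ε * √n < δ := by
    have : Tendsto (fun ε : ℝ => ε * √n) (𝓝 0) (𝓝 (0 * √n)) := by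
      exact (continuous_id.mul continuous_const).tendsto 0
    rw [zero_mul] at this
    exact (this.eventually (gt_mem_nhds hδ)).filter_mono nhdsWithin_le_nhds
  obtain ⟨ε, hε, hε0⟩ := (hcube.and self_mem_nhdsWithin).exists
  have hε0 : 0 < ε := hε0
  refine MvPolynomial.funext_set (fun _ => Set.Icc 0 ε) (fun _ => Set.Icc_infinite hε0) ?_
  intro x hx
  rw [map_zero]
  refine h (WithLp.toLp 2 x) ?_
  rw [mem_ball_zero_iff]
  refine lt_of_le_of_lt ?_ hε
  rw [EuclideanSpace.norm_eq, ← Real.sqrt_sq hε0.le, ← Real.sqrt_mul (sq_nonneg ε)]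
  refine Real.sqrt_le_sqrt ?_
  calc ∑ i, ‖x i‖ ^ 2 ≤ ∑ _i : Fin n, ε ^ 2 := by
        refine Finset.sum_le_sum fun i _ => ?_
        obtain ⟨h0, h1⟩ := hx i trivial
        rw [Real.norm_eq_abs, sq_abs]
        exact pow_le_pow_left₀ h0 h1 2
    _ = ε ^ 2 * n := by simp [mul_comm]

/-- On polynomials of bounded degree the maximum norm on the unit ball is controlled by the `L²`
norm on a concentric ball. -/
theorem exists_sq_le_integral_closedBall (n r : ℕ) {δ : ℝ} (hδ : 0 < δ) :
    ∃ C : ℝ, 0 < C ∧ ∀ p : MvPolynomial (Fin n) ℝ, p.totalDegree ≤ r →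
      ∀ x ∈ Metric.closedBall (0 : Pt n) 1,
        polyFun p x ^ 2 ≤ C * ∫ y in Metric.closedBall (0 : Pt n) δ, polyFun p y ^ 2 := by
  classical
  -- A finite box of exponents containing the support of every polynomial of degree at most `r`. It
  -- also admits some higher degrees, which does no harm.
  set S : Finset (Fin n →₀ ℕ) := Finset.Icc 0 (Finsupp.equivFunOnFinite.symm fun _ => r) with hS
  have hsupp : ∀ p : MvPolynomial (Fin n) ℝ, p.totalDegree ≤ r → p.support ⊆ S := by
    intro p hp m hm
    rw [hS, Finset.mem_Icc]
    refine ⟨zero_le, fun i => ?_⟩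
    have h1 := (MvPolynomial.le_totalDegree hm).trans hp
    rw [Finsupp.sum_fintype _ _ (by simp)] at h1
    exact (Finset.single_le_sum (f := fun j => m j) (fun _ _ => zero_le)
      (Finset.mem_univ i)).trans h1
  set P : (S → ℝ) → MvPolynomial (Fin n) ℝ := fun c => ∑ m : S, MvPolynomial.monomial m.1 (c m)
    with hP
  have hPfun : ∀ c x, polyFun (P c) x = ∑ m : S, c m * ∏ i, x i ^ m.1 i := by
    intro c x
    simp only [polyFun, hP, map_sum, MvPolynomial.eval_monomial]
    refine Finset.sum_congr rfl fun m _ => ?_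
    rw [Finsupp.prod_fintype _ _ (by simp)]
  have hPcoeff : ∀ c (m : S), MvPolynomial.coeff m.1 (P c) = c m := by
    intro c m
    simp only [hP, MvPolynomial.coeff_sum, MvPolynomial.coeff_monomial]
    rw [Finset.sum_eq_single m]
    · simp
    · intro b _ hb
      rw [if_neg fun h => hb (Subtype.ext h)]
    · simp
  have hPsurj : ∀ p : MvPolynomial (Fin n) ℝ, p.totalDegree ≤ r → ∃ c, P c = p := by
    intro p hp
    refine ⟨fun m => MvPolynomial.coeff m.1 p, ?_⟩
    simp only [hP]
    rw [Finset.sum_coe_sort S fun m => MvPolynomial.monomial m (MvPolynomial.coeff m p)]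
    conv_rhs => rw [p.as_sum]
    symm
    refine Finset.sum_subset (hsupp p hp) fun m _ hm => ?_
    rw [MvPolynomial.notMem_support_iff.1 hm, map_zero]
  set F : (S → ℝ) → ℝ := fun c => ∫ y in Metric.closedBall (0 : Pt n) δ, polyFun (P c) y ^ 2
    with hF
  have hFcont : Continuous F := by
    refine continuous_parametric_integral_of_continuous ?_ (isCompact_closedBall 0 δ)
    simp only [Function.uncurry_def, hPfun]
    fun_prop
  -- A zero integral forces the continuous integrand to vanish on the open ball, hence the
  -- polynomial and all its coefficients.
  have hFpos : ∀ c, c ≠ 0 → 0 < F c := by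
    intro c hc
    have hnn : 0 ≤ F c := integral_nonneg fun y => sq_nonneg _
    refine lt_of_le_of_ne hnn fun h0 => hc ?_
    have hcont : Continuous fun y => polyFun (P c) y ^ 2 := (continuous_polyFun _).pow 2
    have hint : IntegrableOn (fun y => polyFun (P c) y ^ 2) (Metric.closedBall (0 : Pt n) δ) :=
      hcont.continuousOn.integrableOn_compact (isCompact_closedBall 0 δ)
    have hae := (setIntegral_eq_zero_iff_of_nonneg_ae
      (Eventually.of_forall fun y => sq_nonneg _) hint).1 h0.symm
    have hae' := ae_restrict_of_ae_restrict_of_subset Metric.ball_subset_closedBall hae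
    have heq := Measure.eqOn_open_of_ae_eq hae' Metric.isOpen_ball hcont.continuousOn
      continuousOn_const
    have hz : P c = 0 := polynomial_eq_zero_of_ball hδ fun x hx => by
      have := heq hx
      simpa using this
    funext m
    rw [← hPcoeff c m, hz, MvPolynomial.coeff_zero]
    rfl
  have hFhom : ∀ (a : ℝ) c, F (a • c) = a ^ 2 * F c := by
    intro a c
    simp only [hF]
    rw [← integral_const_mul]
    congr 1
    funext y
    rw [hPfun, hPfun, ← mul_pow, Finset.mul_sum]
    congr 1
    refine Finset.sum_congr rfl fun m _ => ?_
    simp [mul_assoc]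
  -- Norm equivalence: κ is the minimum of `F` on the unit sphere of coefficients, and homogeneity
  -- of degree two extends the bound to all of them.
  obtain ⟨κ, hκ, hFκ⟩ : ∃ κ : ℝ, 0 < κ ∧ ∀ c, κ * ‖c‖ ^ 2 ≤ F c := by
    rcases isEmpty_or_nonempty S with hE | hE
    · refine ⟨1, one_pos, fun c => ?_⟩
      have : c = 0 := Subsingleton.elim _ _
      rw [this]
      simpa using integral_nonneg fun y => sq_nonneg _
    · have hsph : (Metric.sphere (0 : S → ℝ) 1).Nonempty := by
        refine ⟨fun _ => 1, ?_⟩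
        rw [mem_sphere_zero_iff_norm, pi_norm_const]
        simp
      obtain ⟨c₀, hc₀, hmin⟩ := (isCompact_sphere (0 : S → ℝ) 1).exists_isMinOn hsph
        hFcont.continuousOn
      have hc₀' : c₀ ≠ 0 := by
        rintro rfl
        simp at hc₀
      refine ⟨F c₀, hFpos c₀ hc₀', fun c => ?_⟩
      by_cases hc : c = 0
      · rw [hc]
        simpa using integral_nonneg fun y => sq_nonneg _
      · have hn0 : ‖c‖ ≠ 0 := norm_ne_zero_iff.2 hc
        have h1 : F c₀ ≤ F (‖c‖⁻¹ • c) := hmin (by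
          rw [mem_sphere_zero_iff_norm, norm_smul, norm_inv, norm_norm, inv_mul_cancel₀ hn0])
        rw [hFhom] at h1
        calc F c₀ * ‖c‖ ^ 2 ≤ (‖c‖⁻¹ ^ 2 * F c) * ‖c‖ ^ 2 := by gcongr
          _ = F c := by field_simp
  -- Every monomial is at most 1 in absolute value on the unit ball, so the polynomial is at most
  -- `S.card * ‖c‖` there; the summand 1 only makes the constant visibly positive.
  refine ⟨((S.card : ℝ) ^ 2 + 1) / κ, by positivity, fun p hp x hx => ?_⟩
  obtain ⟨c, rfl⟩ := hPsurj p hp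
  have hx1 : ∀ i, |x i| ≤ 1 := fun i => by
    have := (PiLp.norm_apply_le x i).trans (mem_closedBall_zero_iff.1 hx)
    rwa [Real.norm_eq_abs] at this
  have hb : |polyFun (P c) x| ≤ S.card * ‖c‖ := by
    rw [hPfun]
    calc |∑ m : S, c m * ∏ i, x i ^ m.1 i| ≤ ∑ m : S, |c m * ∏ i, x i ^ m.1 i| :=
          Finset.abs_sum_le_sum_abs _ _
      _ ≤ ∑ _m : S, ‖c‖ := by
          refine Finset.sum_le_sum fun m _ => ?_
          rw [abs_mul, Finset.abs_prod]
          have h1 : ∏ i, |x i ^ m.1 i| ≤ 1 := Finset.prod_le_one (fun _ _ => abs_nonneg _)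
            fun i _ => by rw [abs_pow]; exact pow_le_one₀ (abs_nonneg _) (hx1 i)
          have h2 : |c m| ≤ ‖c‖ := norm_le_pi_norm c m
          calc |c m| * ∏ i, |x i ^ m.1 i| ≤ |c m| * 1 := by gcongr
            _ ≤ ‖c‖ := by rwa [mul_one]
      _ = S.card * ‖c‖ := by simp
  have h3 := hFκ c
  calc polyFun (P c) x ^ 2 = |polyFun (P c) x| ^ 2 := (sq_abs _).symm
    _ ≤ (S.card * ‖c‖) ^ 2 := by gcongr
    _ = (S.card : ℝ) ^ 2 / κ * (κ * ‖c‖ ^ 2) := by field_simp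
    _ ≤ ((S.card : ℝ) ^ 2 + 1) / κ * F c := by
        gcongr
        linarith

/-! ### The inverse trace inequality -/

theorem surf_frontier_hull_le {s : Finset (Pt n)} (hn : 0 < n)
    (hs : AffineIndependent ℝ ((↑) : s → Pt n)) (hc : s.card = n + 1) :
    surf n (frontier (hull s)) ≤ (n + 1 : ℕ) * (ENNReal.ofReal (meshSize s ^ (n - 1)) *
      volume (Metric.closedBall (0 : Pt (n - 1)) 1)) := by
  classical
  calc surf n (frontier (hull s)) ≤ surf n (⋃ i ∈ s, hull (s.erase i)) :=
        measure_mono (frontier_hull_subset hs hc)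
    _ ≤ ∑ i ∈ s, surf n (hull (s.erase i)) := measure_biUnion_finset_le _ _
    _ ≤ ∑ _i ∈ s, ENNReal.ofReal (meshSize s ^ (n - 1)) *
          volume (Metric.closedBall (0 : Pt (n - 1)) 1) := by
        refine Finset.sum_le_sum fun i hi => surf_hull_le ?_ ?_ hn ?_
        · exact hs.mono (Finset.coe_subset.2 (Finset.erase_subset i s))
        · rw [Finset.card_erase_of_mem hi, hc]; rfl
        · have hsub : hull (s.erase i) ⊆ hull s :=
            convexHull_mono (Finset.coe_subset.2 (Finset.erase_subset i s))
          exact fun x hx y hy => Metric.dist_le_diam_of_mem (isCompact_hull s).isBounded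
            (hsub hx) (hsub hy)
    _ = _ := by rw [Finset.sum_const, hc, nsmul_eq_mul]

/-- A shape regular simplex contains a ball whose radius is comparable to its diameter. -/
theorem exists_closedBall_subset_hull {s : Finset (Pt n)} {σ : ℝ} (h0 : 0 < meshSize s)
    (hσ : meshSize s ≤ σ * ballDiam s) :
    ∃ c, Metric.closedBall c (meshSize s * (4 * (|σ| + 1))⁻¹) ⊆ hull s := by
  set A := {d : ℝ | 0 ≤ d ∧ ∃ c : Pt n, Metric.closedBall c (d / 2) ⊆ hull s} with hA
  have hρ : ballDiam s = sSup A := rfl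
  have hρ0 : 0 ≤ ballDiam s := hρ ▸ Real.sSup_nonneg fun d hd => hd.1
  have hρpos : 0 < ballDiam s := by
    refine lt_of_le_of_ne hρ0 fun h => ?_
    rw [← h, mul_zero] at hσ
    linarith
  -- The supremum of the empty set is 0 by convention, which positivity of `ballDiam s` excludes.
  have hne : A.Nonempty := by
    by_contra hA0
    rw [Set.not_nonempty_iff_eq_empty] at hA0
    rw [hρ, hA0, Real.sSup_empty] at hρpos
    exact lt_irrefl _ hρpos
  -- The supremum need not be attained, so half of it is taken. Since the radius is d/2, a second
  -- factor 2 appears, whence the 4 in the radius.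
  obtain ⟨d, ⟨hd0, c, hc⟩, hd⟩ := exists_lt_of_lt_csSup hne (show ballDiam s / 2 < sSup A by
    rw [← hρ]; linarith)
  refine ⟨c, (Metric.closedBall_subset_closedBall ?_).trans hc⟩
  have hσ' : meshSize s ≤ (|σ| + 1) * (2 * d) := by
    calc meshSize s ≤ σ * ballDiam s := hσ
      _ ≤ (|σ| + 1) * ballDiam s := by
          gcongr
          linarith [le_abs_self σ]
      _ ≤ _ := by gcongr; linarith
  rw [← div_eq_mul_inv, div_le_iff₀ (by positivity)]
  linarith

theorem setIntegral_comp_affine {f : Pt n → ℝ} (c : Pt n) {h δ : ℝ} (hh : 0 < h) (hδ : 0 ≤ δ) :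
    ∫ y in Metric.closedBall (0 : Pt n) δ, f (c + h • y)
      = (h ^ n)⁻¹ * ∫ x in Metric.closedBall c (h * δ), f x := by
  have h1 := Measure.setIntegral_comp_smul volume (fun z : Pt n => f (c + z))
    (Metric.closedBall (0 : Pt n) δ) hh.ne'
  rw [h1, finrank_euclideanSpace_fin, smul_closedBall _ _ hδ, smul_zero, Real.norm_of_nonneg hh.le,
    abs_of_pos (by positivity), smul_eq_mul]
  congr 1
  have h2 := (measurePreserving_add_left (volume : Measure (Pt n)) c).setIntegral_preimage_emb
    (measurableEmbedding_addLeft c) f (Metric.closedBall c (h * δ))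
  rw [← h2]
  congr 2
  ext x
  simp

/-- The sup bound on the simplex scales like h⁻ⁿ and the boundary measure like hⁿ⁻¹. The constants
are chosen before the simplex and depend only on `n`, `r` and σ. -/
theorem exists_traceIneq (hn : 2 ≤ n) (r : ℕ) (σ : ℝ) :
    ∃ C : ℝ, 0 < C ∧ ∀ s : Finset (Pt n), AffineIndependent ℝ ((↑) : s → Pt n) →
      s.card = n + 1 → meshSize s ≤ σ * ballDiam s →
      ∀ e ⊆ frontier (hull s), TraceIneq r C s e := by
  have hδ : 0 < (4 * (|σ| + 1))⁻¹ := by positivity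
  obtain ⟨C₁, hC₁, hball⟩ := exists_sq_le_integral_closedBall n r hδ
  set δ := (4 * (|σ| + 1))⁻¹
  set V : ℝ := (volume (Metric.closedBall (0 : Pt (n - 1)) 1)).toReal with hV
  have hVtop : volume (Metric.closedBall (0 : Pt (n - 1)) 1) ≠ ⊤ := measure_closedBall_lt_top.ne
  have hV0 : 0 ≤ V := ENNReal.toReal_nonneg
  set κ : ℝ := C₁ * ((n + 1) * V) with hκ
  have hκ0 : 0 ≤ κ := by positivity
  -- The square of √κ + 1 dominates κ, and the summand 1 keeps the constant positive when κ = 0.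
  refine ⟨√κ + 1, by positivity, fun s hs hc hσ e he p hp => ?_⟩
  have hh : 0 < meshSize s := meshSize_pos (by omega)
  set h := meshSize s with hhdef
  obtain ⟨c, hcs⟩ := exists_closedBall_subset_hull hh hσ
  obtain ⟨q, hq, hqp⟩ := exists_polyFun_comp_affine hp c h
  set I := ∫ x in hull s, polyFun p x ^ 2 with hI
  have hI0 : 0 ≤ I := integral_nonneg fun x => sq_nonneg _
  have hcmem : c ∈ hull s := hcs (Metric.mem_closedBall_self (by positivity))
  have hcont : Continuous fun x => polyFun p x ^ 2 := (continuous_polyFun p).pow 2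
  have hsup : ∀ x ∈ hull s, polyFun p x ^ 2 ≤ C₁ * ((h ^ n)⁻¹ * I) := by
    intro x hx
    have hy : h⁻¹ • (x - c) ∈ Metric.closedBall (0 : Pt n) 1 := by
      rw [mem_closedBall_zero_iff, norm_smul, norm_inv, Real.norm_of_nonneg hh.le, ← dist_eq_norm,
        inv_mul_le_iff₀ hh, mul_one]
      exact Metric.dist_le_diam_of_mem (isCompact_hull s).isBounded hx hcmem
    have h1 := hball q hq _ hy
    have h2 : polyFun q (h⁻¹ • (x - c)) = polyFun p x := by
      rw [hqp, smul_inv_smul₀ hh.ne', add_sub_cancel]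
    have h3 : ∫ y in Metric.closedBall (0 : Pt n) δ, polyFun q y ^ 2 ≤ (h ^ n)⁻¹ * I := by
      simp only [hqp]
      rw [setIntegral_comp_affine (f := fun x => polyFun p x ^ 2) c hh hδ.le]
      gcongr
      exact setIntegral_mono_set (hcont.continuousOn.integrableOn_compact (isCompact_hull s))
        (Eventually.of_forall fun _ => sq_nonneg _) hcs.eventuallyLE
    rw [h2] at h1
    exact h1.trans (by gcongr)
  have hfront := surf_frontier_hull_le (by omega) hs hc
  rw [← hhdef] at hfront
  have htop : (n + 1 : ℕ) * (ENNReal.ofReal (h ^ (n - 1)) *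
      volume (Metric.closedBall (0 : Pt (n - 1)) 1)) ≠ ⊤ :=
    ENNReal.mul_ne_top (ENNReal.natCast_ne_top _) (ENNReal.mul_ne_top ENNReal.ofReal_ne_top hVtop)
  have hse : surf n e ≤ _ := (measure_mono he).trans hfront
  have hreal : (surf n).real e ≤ (n + 1) * (h ^ (n - 1) * V) := by
    have h1 := ENNReal.toReal_mono htop hse
    rw [ENNReal.toReal_mul, ENNReal.toReal_mul, ENNReal.toReal_ofReal (by positivity),
      ENNReal.toReal_natCast] at h1
    exact_mod_cast h1
  have hfr : frontier (hull s) ⊆ hull s := (isCompact_hull s).isClosed.frontier_subset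
  have hint : ∫ x in e, polyFun p x ^ 2 ∂(surf n) ≤ κ * h⁻¹ * I := by
    -- Supremum times measure; no measurability of `e` is needed here.
    have h1 := norm_setIntegral_le_of_norm_le_const (μ := surf n) (s := e)
      (f := fun x => polyFun p x ^ 2) (C := C₁ * ((h ^ n)⁻¹ * I)) (hse.trans_lt htop.lt_top)
      (fun x hx => by
        rw [Real.norm_of_nonneg (sq_nonneg _)]
        exact hsup x (hfr (he hx)))
    refine (le_abs_self _).trans (h1.trans ?_)
    calc C₁ * ((h ^ n)⁻¹ * I) * (surf n).real e
        ≤ C₁ * ((h ^ n)⁻¹ * I) * ((n + 1) * (h ^ (n - 1) * V)) := by gcongr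
      _ = κ * h⁻¹ * I := by
          have : h ^ n = h ^ (n - 1) * h := by rw [← pow_succ]; congr 1; omega
          rw [this, hκ]
          field_simp
  change √(∫ x in e, polyFun p x ^ 2 ∂(surf n)) ≤ (√κ + 1) * (√h)⁻¹ * √I
  refine Real.sqrt_le_iff.2 ⟨by positivity, hint.trans ?_⟩
  rw [mul_pow, mul_pow, inv_pow, Real.sq_sqrt hh.le, Real.sq_sqrt hI0]
  gcongr
  nlinarith [Real.sq_sqrt hκ0, Real.sqrt_nonneg κ]

theorem facetUnion_subset_frontier {M : HybridMesh n} {F : Finset (Finset (Pt n) × Finset (Pt n))}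
    (hF : F ∈ ({M.Eh, M.EH} : Set (Finset (Finset (Pt n) × Finset (Pt n)))))
    (s : Finset (Pt n)) : facetUnion F s ⊆ frontier (hull s) := by
  have key : ∀ (T : Geometry.SimplicialComplex ℝ (Pt n)) f, (s, f) ∈ M.facetSet T →
      hull f ⊆ frontier (hull s) := by
    rintro T f ⟨hs, hfs, hf, -⟩
    refine hull_subset_frontier (T.indep hs.1) hs.2 (hfs.ssubset_of_ne ?_)
    rintro h
    have := hs.2
    change f = s at h
    change s.card = n + 1 at this
    change f.card = n at hf
    rw [h] at hf
    omega
  refine Set.iUnion₂_subset fun f hf => ?_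
  rcases hF with rfl | rfl
  · exact key _ f ((M.facetSet_finite M.finite_Th).mem_toFinset.1 hf)
  · exact key _ f ((M.facetSet_finite M.finite_TH).mem_toFinset.1 hf)

theorem HybridMesh.indep {M : HybridMesh n} {s : Finset (Pt n)} (hs : s ∈ M.allElements) :
    AffineIndependent ℝ ((↑) : s → Pt n) ∧ s.card = n + 1 := by
  rcases hs with hs | hs
  · exact ⟨M.Th.indep hs.1, hs.2⟩
  · exact ⟨M.TH.indep hs.1, hs.2⟩

theorem exists_isTraceConst (hn : 2 ≤ n) (r : ℕ) (σ : ℝ) :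
    ∃ C : ℝ, 0 < C ∧ ∀ M : HybridMesh n, M.ShapeRegular σ → M.IsTraceConst r C ∧
      ∀ s ∈ M.allElements, ∀ e ⊆ frontier (hull s), TraceIneq r C s e := by
  obtain ⟨C, hC, h⟩ := exists_traceIneq hn r σ
  refine ⟨C, hC, fun M hM => ?_⟩
  have hall : ∀ s ∈ M.allElements, ∀ e ⊆ frontier (hull s), TraceIneq r C s e := fun s hs =>
    h s (HybridMesh.indep hs).1 (HybridMesh.indep hs).2 (hM s hs)
  refine ⟨⟨fun s hs f hfs hf => hall s hs _ ?_, fun F hF s hs _ =>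
    hall s hs _ (facetUnion_subset_frontier hF s)⟩, hall⟩
  obtain ⟨hi, hc⟩ := HybridMesh.indep hs
  refine hull_subset_frontier hi hc (hfs.ssubset_of_ne ?_)
  rintro rfl
  omega

/-! ### Integrals over almost disjoint finite unions -/

section Integral

variable {α ι : Type*} [MeasurableSpace α] {μ : Measure α}

theorem restrict_biUnion_finset_eq_sum (t : Finset ι) {A : ι → Set α}
    (hm : ∀ i ∈ t, MeasurableSet (A i))
    (hd : ∀ i ∈ t, ∀ j ∈ t, i ≠ j → μ (A i ∩ A j) = 0) :
    μ.restrict (⋃ i ∈ t, A i) = ∑ i ∈ t, μ.restrict (A i) := by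
  classical
  induction t using Finset.induction_on with
  | empty => simp
  | insert a t ha ih =>
    rw [Finset.set_biUnion_insert, Finset.sum_insert ha,
      ← ih (fun i hi => hm i (Finset.mem_insert_of_mem hi))
        (fun i hi j hj => hd i (Finset.mem_insert_of_mem hi) j (Finset.mem_insert_of_mem hj))]
    refine Measure.restrict_union₀ ?_ (Finset.measurableSet_biUnion t fun i hi =>
      hm i (Finset.mem_insert_of_mem hi)).nullMeasurableSet
    change μ (A a ∩ ⋃ i ∈ t, A i) = 0
    rw [Set.inter_iUnion₂]
    refine (measure_biUnion_null_iff t.countable_toSet).2 fun i hi => ?_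
    exact hd a (Finset.mem_insert_self _ _) i (Finset.mem_insert_of_mem hi)
      (fun h => ha (h ▸ hi))

theorem setIntegral_biUnion_finset_eq_sum (t : Finset ι) {A : ι → Set α} {f : α → ℝ}
    (hm : ∀ i ∈ t, MeasurableSet (A i))
    (hd : ∀ i ∈ t, ∀ j ∈ t, i ≠ j → μ (A i ∩ A j) = 0)
    (hf : ∀ i ∈ t, IntegrableOn f (A i) μ) :
    ∫ x in ⋃ i ∈ t, A i, f x ∂μ = ∑ i ∈ t, ∫ x in A i, f x ∂μ := by
  rw [restrict_biUnion_finset_eq_sum t hm hd, integral_finsetSum_measure hf]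

theorem sum_setIntegral_le (t : Finset ι) {A : ι → Set α} {B : Set α} {f : α → ℝ}
    (hm : ∀ i ∈ t, MeasurableSet (A i))
    (hd : ∀ i ∈ t, ∀ j ∈ t, i ≠ j → μ (A i ∩ A j) = 0) (hA : ∀ i ∈ t, A i ⊆ B)
    (hf : IntegrableOn f B μ) (h0 : ∀ x, 0 ≤ f x) :
    ∑ i ∈ t, ∫ x in A i, f x ∂μ ≤ ∫ x in B, f x ∂μ := by
  rw [← setIntegral_biUnion_finset_eq_sum t hm hd fun i hi => hf.mono_set (hA i hi)]
  exact setIntegral_mono_set hf (Eventually.of_forall h0)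
    (Set.iUnion₂_subset hA).eventuallyLE

theorem integral_mul_le_sqrt_mul_sqrt {f g : α → ℝ} (hf : MemLp f 2 μ) (hg : MemLp g 2 μ)
    (hf0 : ∀ x, 0 ≤ f x) (hg0 : ∀ x, 0 ≤ g x) :
    ∫ x, f x * g x ∂μ ≤ √(∫ x, f x ^ 2 ∂μ) * √(∫ x, g x ^ 2 ∂μ) := by
  have h := integral_mul_le_Lp_mul_Lq_of_nonneg (μ := μ) Real.HolderConjugate.two_two
    (Eventually.of_forall hf0) (Eventually.of_forall hg0) (by simpa using hf) (by simpa using hg)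
  simpa [Real.sqrt_eq_rpow] using h

end Integral

/-! ### Finite element functions and their gradients -/

/-- The elements of a finite triangulation. -/
def elementFinset {T : Geometry.SimplicialComplex ℝ (Pt n)} (hT : T.faces.Finite) :
    Finset (Finset (Pt n)) :=
  (hT.subset fun _ hs => hs.1 : (elements T).Finite).toFinset

theorem mem_elementFinset {T : Geometry.SimplicialComplex ℝ (Pt n)} {hT : T.faces.Finite}
    {s : Finset (Pt n)} : s ∈ elementFinset hT ↔ s ∈ elements T := by
  simp [elementFinset]

section Region

variable {T : Geometry.SimplicialComplex ℝ (Pt n)}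

theorem space_eq_biUnion (hT : T.faces.Finite)
    (hp : ∀ f ∈ T.faces, ∃ s ∈ elements T, f ⊆ s) :
    T.space = ⋃ s ∈ elementFinset hT, hull s := by
  refine Set.Subset.antisymm (Set.iUnion₂_subset fun f hf => ?_)
    (Set.iUnion₂_subset fun s hs => T.convexHull_subset_space (mem_elementFinset.1 hs).1)
  obtain ⟨s, hs, hfs⟩ := hp f hf
  exact (convexHull_mono (Finset.coe_subset.2 hfs)).trans
    (Set.subset_biUnion_of_mem (u := fun s => hull s) (mem_elementFinset.2 hs))

theorem isCompact_space (hT : T.faces.Finite) : IsCompact T.space :=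
  hT.isCompact_biUnion fun s _ => isCompact_hull s

theorem setIntegral_space (hT : T.faces.Finite)
    (hp : ∀ f ∈ T.faces, ∃ s ∈ elements T, f ⊆ s) {f : Pt n → ℝ}
    (hf : ∀ s ∈ elements T, IntegrableOn f (hull s)) :
    ∫ x in T.space, f x = ∑ s ∈ elementFinset hT, ∫ x in hull s, f x := by
  rw [space_eq_biUnion hT hp]
  exact setIntegral_biUnion_finset_eq_sum _ (fun s _ => measurableSet_hull s)
    (fun s hs t ht => volume_hull_inter_eq_zero (mem_elementFinset.1 hs) (mem_elementFinset.1 ht))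
    fun s hs => hf s (mem_elementFinset.1 hs)

/-- The boundary of a convex set is null. Only in the interior does the polynomial piece determine
the ambient gradient. -/
theorem ae_mem_interior_hull (s : Finset (Pt n)) :
    ∀ᵐ x ∂(volume.restrict (hull s)), x ∈ interior (hull s) := by
  rw [ae_restrict_iff' (measurableSet_hull s)]
  have h0 : volume (frontier (hull s)) = 0 :=
    Convex.addHaar_frontier volume (convex_convexHull ℝ _)
  filter_upwards [measure_eq_zero_iff_ae_notMem.1 h0] with x hx hxs
  by_contra hi
  exact hx ⟨subset_closure hxs, hi⟩

/-- `P s` is the polynomial that `v` agrees with on the element `s`. -/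
def IsPieces (r : ℕ) (T : Geometry.SimplicialComplex ℝ (Pt n)) (v : Pt n → ℝ)
    (P : Finset (Pt n) → MvPolynomial (Fin n) ℝ) : Prop :=
  ∀ s ∈ elements T, (P s).totalDegree ≤ r ∧ ∀ x ∈ hull s, v x = polyFun (P s) x

theorem exists_isPieces {r : ℕ} {v : Pt n → ℝ} (hv : v ∈ FESpace r T) : ∃ P, IsPieces r T v P := by
  choose! P hP using hv.2
  exact ⟨P, hP⟩

variable {r : ℕ} {v : Pt n → ℝ} {P : Finset (Pt n) → MvPolynomial (Fin n) ℝ}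

theorem IsPieces.gradient_eq (hP : IsPieces r T v P) {s : Finset (Pt n)} (hs : s ∈ elements T)
    {x : Pt n} (hx : x ∈ interior (hull s)) : gradient v x = polyGrad (P s) x := by
  refine ((hasGradientAt_polyFun (P s) x).congr_of_eventuallyEq ?_).gradient
  filter_upwards [mem_interior_iff_mem_nhds.1 hx] with y hy
  exact (hP s hs).2 y hy

/-- A convex set with nonempty interior is a set of unique differentiability, so the one-sided
gradient is determined by the piece up to the boundary. This gives the traces in the flux. -/
theorem IsPieces.gradientWithin_eq (hP : IsPieces r T v P) {s : Finset (Pt n)}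
    (hs : s ∈ elements T) {x : Pt n} (hx : x ∈ hull s) :
    gradientWithin v (hull s) x = polyGrad (P s) x := by
  have hu : UniqueDiffWithinAt ℝ (hull s) x :=
    uniqueDiffOn_convex (convex_convexHull ℝ _) (interior_hull_nonempty (T.indep hs.1) hs.2) x hx
  have h1 : HasFDerivWithinAt v (InnerProductSpace.toDual ℝ (Pt n) (polyGrad (P s) x))
      (hull s) x :=
    ((hasGradientAt_polyFun (P s) x).hasFDerivAt.hasFDerivWithinAt).congr
      (fun y hy => (hP s hs).2 y hy) ((hP s hs).2 x hx)
  rw [gradientWithin, h1.fderivWithin hu, LinearIsometryEquiv.symm_apply_apply]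

theorem IsPieces.gradient_ae_eq (hP : IsPieces r T v P) {s : Finset (Pt n)}
    (hs : s ∈ elements T) : gradient v =ᵐ[volume.restrict (hull s)] polyGrad (P s) := by
  filter_upwards [ae_mem_interior_hull s] with x hx
  exact hP.gradient_eq hs hx

theorem integrableOn_hull {E : Type*} [NormedAddCommGroup E] {f : Pt n → E} (hf : Continuous f)
    (s : Finset (Pt n)) : IntegrableOn f (hull s) :=
  hf.continuousOn.integrableOn_compact (isCompact_hull s)

theorem IsPieces.integrableOn_sq (hP : IsPieces r T v P) {s : Finset (Pt n)}
    (hs : s ∈ elements T) : IntegrableOn (fun x => ‖gradient v x‖ ^ 2) (hull s) := by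
  refine (integrableOn_hull ((continuous_polyGrad (P s)).norm.pow 2) s).congr ?_
  filter_upwards [hP.gradient_ae_eq hs] with x hx
  simp [hx]

theorem IsPieces.memLp_gradient (hP : IsPieces r T v P) (hT : T.faces.Finite)
    (hp : ∀ f ∈ T.faces, ∃ s ∈ elements T, f ⊆ s) :
    MemLp (gradient v) 2 (volume.restrict T.space) := by
  rw [space_eq_biUnion hT hp]
  have h1 : IntegrableOn (gradient v) (⋃ s ∈ elementFinset hT, hull s) :=
    integrableOn_finset_iUnion.2 fun s hs =>
      (integrableOn_hull (continuous_polyGrad (P s)) s).congr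
        (hP.gradient_ae_eq (mem_elementFinset.1 hs)).symm
  rw [memLp_two_iff_integrable_sq_norm h1.aestronglyMeasurable]
  exact integrableOn_finset_iUnion.2 fun s hs => hP.integrableOn_sq (mem_elementFinset.1 hs)

theorem IsPieces.integral_sq_gradient (hP : IsPieces r T v P) (hT : T.faces.Finite)
    (hp : ∀ f ∈ T.faces, ∃ s ∈ elements T, f ⊆ s) :
    ∫ x in T.space, ‖gradient v x‖ ^ 2
      = ∑ s ∈ elementFinset hT, ∫ x in hull s, ‖polyGrad (P s) x‖ ^ 2 := by
  rw [setIntegral_space hT hp fun s hs => hP.integrableOn_sq hs]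
  refine Finset.sum_congr rfl fun s hs => integral_congr_ae ?_
  filter_upwards [hP.gradient_ae_eq (mem_elementFinset.1 hs)] with x hx
  rw [hx]

end Region

/-! ### The coefficient -/

/-- The pointwise condition in the class `ℳ(lam, Lam; D)`. -/
def coeffSet (n : ℕ) (lam Lam : ℝ) : Set (Pt n →L[ℝ] Pt n) :=
  {A | ∀ ξ : Pt n, lam * ‖ξ‖ ^ 2 ≤ inner ℝ ξ (A ξ) ∧ 1 / Lam * ‖A ξ‖ ^ 2 ≤ inner ℝ ξ (A ξ)}

variable {lam Lam : ℝ}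

/-- Cauchy–Schwarz gives |Aξ|²/Λ ≤ ξ·Aξ ≤ |ξ||Aξ|; then divide by |Aξ|. -/
theorem norm_apply_le_of_mem_coeffSet (hLam : 0 < Lam) {A : Pt n →L[ℝ] Pt n}
    (hA : A ∈ coeffSet n lam Lam) (ξ : Pt n) : ‖A ξ‖ ≤ Lam * ‖ξ‖ := by
  have h1 := (hA ξ).2.trans (real_inner_le_norm ξ (A ξ))
  rcases (norm_nonneg (A ξ)).eq_or_lt with h0 | h0
  · rw [← h0]; positivity
  · rw [one_div, inv_mul_le_iff₀ hLam] at h1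
    nlinarith

theorem norm_le_of_mem_coeffSet (hLam : 0 < Lam) {A : Pt n →L[ℝ] Pt n}
    (hA : A ∈ coeffSet n lam Lam) : ‖A‖ ≤ Lam :=
  A.opNorm_le_bound hLam.le (norm_apply_le_of_mem_coeffSet hLam hA)

theorem isClosed_coeffSet : IsClosed (coeffSet n lam Lam) := by
  simp only [coeffSet, Set.ofPred_forall, Set.ofPred_and]
  refine isClosed_iInter fun ξ => (isClosed_le ?_ ?_).inter (isClosed_le ?_ ?_) <;> fun_prop

/-- The right-hand sides ξ·Aξ are linear in A, and |Aξ|² is convex in A. Convexity is what lets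
averages, and then traces, inherit the bounds. -/
theorem convex_coeffSet (hLam : 0 < Lam) : Convex ℝ (coeffSet n lam Lam) := by
  intro A hA B hB a b ha hb hab ξ
  obtain ⟨hA1, hA2⟩ := hA ξ
  obtain ⟨hB1, hB2⟩ := hB ξ
  simp only [add_apply, smul_apply, inner_add_right,
    inner_smul_right]
  have hL : 0 < 1 / Lam := by positivity
  constructor
  · have : lam * ‖ξ‖ ^ 2 = a * (lam * ‖ξ‖ ^ 2) + b * (lam * ‖ξ‖ ^ 2) := by
      rw [← add_mul, hab, one_mul]
    rw [this]
    gcongr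
  · have hcv : ‖a • A ξ + b • B ξ‖ ^ 2 ≤ a * ‖A ξ‖ ^ 2 + b * ‖B ξ‖ ^ 2 := by
      have h1 : ‖a • A ξ + b • B ξ‖ ≤ a * ‖A ξ‖ + b * ‖B ξ‖ := by
        refine (norm_add_le _ _).trans ?_
        rw [norm_smul, norm_smul, Real.norm_of_nonneg ha, Real.norm_of_nonneg hb]
      have h2 := (convexOn_pow 2).2 (norm_nonneg (A ξ)) (norm_nonneg (B ξ)) ha hb hab
      simp only [smul_eq_mul] at h2
      exact (pow_le_pow_left₀ (norm_nonneg _) h1 2).trans h2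
    calc 1 / Lam * ‖a • A ξ + b • B ξ‖ ^ 2 ≤ 1 / Lam * (a * ‖A ξ‖ ^ 2 + b * ‖B ξ‖ ^ 2) := by gcongr
      _ = a * (1 / Lam * ‖A ξ‖ ^ 2) + b * (1 / Lam * ‖B ξ‖ ^ 2) := by ring
      _ ≤ _ := by gcongr

/-! ### Bulk integrals with a coefficient in the class -/

section Energy

variable {b : Pt n → (Pt n →L[ℝ] Pt n)}

theorem integrable_inner_of_coeff {μ : Measure (Pt n)} {g g' : Pt n → Pt n} (hLam : 0 < Lam)
    (hbm : AEStronglyMeasurable b μ) (hb : ∀ᵐ x ∂μ, b x ∈ coeffSet n lam Lam)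
    (hg : MemLp g 2 μ) (hg' : MemLp g' 2 μ) :
    Integrable (fun x => inner ℝ (b x (g x)) (g' x)) μ := by
  have hdom : Integrable (fun x => Lam * (‖g x‖ * ‖g' x‖)) μ :=
    (MemLp.integrable_mul hg.norm hg'.norm).const_mul Lam
  refine hdom.mono' ?_ ?_
  · have happ : Continuous fun p : (Pt n →L[ℝ] Pt n) × Pt n => p.1 p.2 :=
      isBoundedBilinearMap_apply.continuous
    exact (happ.comp_aestronglyMeasurable (hbm.prodMk hg.1)).inner hg'.1
  · filter_upwards [hb] with x hx
    refine (norm_inner_le_norm _ _).trans ?_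
    rw [← mul_assoc]
    gcongr
    exact norm_apply_le_of_mem_coeffSet hLam hx _

theorem abs_integral_inner_le {μ : Measure (Pt n)} {g g' : Pt n → Pt n} (hLam : 0 < Lam)
    (hb : ∀ᵐ x ∂μ, b x ∈ coeffSet n lam Lam)
    (hg : MemLp g 2 μ) (hg' : MemLp g' 2 μ) :
    |∫ x, inner ℝ (b x (g x)) (g' x) ∂μ| ≤
      Lam * (√(∫ x, ‖g x‖ ^ 2 ∂μ) * √(∫ x, ‖g' x‖ ^ 2 ∂μ)) := by
  have hdom : Integrable (fun x => Lam * (‖g x‖ * ‖g' x‖)) μ :=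
    (MemLp.integrable_mul hg.norm hg'.norm).const_mul Lam
  rw [← Real.norm_eq_abs]
  refine (norm_integral_le_of_norm_le hdom ?_).trans ?_
  · filter_upwards [hb] with x hx
    refine (norm_inner_le_norm _ _).trans ?_
    rw [← mul_assoc]
    gcongr
    exact norm_apply_le_of_mem_coeffSet hLam hx _
  · rw [integral_const_mul]
    gcongr
    exact integral_mul_le_sqrt_mul_sqrt hg.norm hg'.norm (fun _ => norm_nonneg _)
      fun _ => norm_nonneg _

theorem le_integral_inner {μ : Measure (Pt n)} {g : Pt n → Pt n} (hLam : 0 < Lam)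
    (hbm : AEStronglyMeasurable b μ) (hb : ∀ᵐ x ∂μ, b x ∈ coeffSet n lam Lam)
    (hg : MemLp g 2 μ) :
    lam * ∫ x, ‖g x‖ ^ 2 ∂μ ≤ ∫ x, inner ℝ (b x (g x)) (g x) ∂μ := by
  rw [← integral_const_mul]
  refine integral_mono_ae ?_ (integrable_inner_of_coeff hLam hbm hb hg hg) ?_
  · exact ((memLp_two_iff_integrable_sq_norm hg.1).1 hg).const_mul lam
  · filter_upwards [hb] with x hx
    rw [real_inner_comm]
    exact (hx _).1

end Energy

/-! ### Traces of the coefficient -/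

section Trace

variable {T : Geometry.SimplicialComplex ℝ (Pt n)} {D : Set (Pt n)}
  {b β : Pt n → (Pt n →L[ℝ] Pt n)}

/-- Only the open elements are assumed to lie in `D`; their boundaries are null. -/
theorem space_ae_le (hT : T.faces.Finite) (hp : ∀ f ∈ T.faces, ∃ s ∈ elements T, f ⊆ s)
    (hD : ∀ s ∈ elements T, interior (hull s) ⊆ D) : T.space ≤ᵐ[volume] D := by
  rw [ae_le_set]
  have hsub : T.space \ D ⊆ ⋃ s ∈ elementFinset hT, frontier (hull s) := by
    rintro x ⟨hx, hxD⟩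
    rw [space_eq_biUnion hT hp] at hx
    simp only [Set.mem_iUnion] at hx ⊢
    obtain ⟨s, hs, hxs⟩ := hx
    exact ⟨s, hs, subset_closure hxs, fun h => hxD (hD s (mem_elementFinset.1 hs) h)⟩
  refine measure_mono_null hsub ?_
  exact (measure_biUnion_null_iff (elementFinset hT).countable_toSet).2 fun s _ =>
    Convex.addHaar_frontier volume (convex_convexHull ℝ _)

theorem ae_mem_coeffSet (hb : b ∈ CoeffClass lam Lam D) {K : Set (Pt n)}
    (hK : K ≤ᵐ[volume] D) : ∀ᵐ x ∂(volume.restrict K), b x ∈ coeffSet n lam Lam :=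
  ae_mono (Measure.restrict_mono_ae hK) hb.2

theorem average_mem_coeffSet (hLam : 0 < Lam) (hb : b ∈ CoeffClass lam Lam D)
    (hK : T.space ≤ᵐ[volume] D) {s : Finset (Pt n)} (hs : s ∈ elements T) {x : Pt n}
    (hx : x ∈ hull s) {δ : ℝ} (hδ : 0 < δ) :
    ⨍ y in Metric.ball x δ ∩ T.space, b y ∈ coeffSet n lam Lam := by
  have hle : (Metric.ball x δ ∩ T.space : Set (Pt n)) ≤ᵐ[volume] D :=
    (Set.inter_subset_right.eventuallyLE).trans hK
  have hfin : volume (Metric.ball x δ ∩ T.space) < ⊤ :=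
    (measure_mono Set.inter_subset_left).trans_lt measure_ball_lt_top
  have : IsFiniteMeasure (volume.restrict (Metric.ball x δ ∩ T.space)) := ⟨by simpa using hfin⟩
  refine (convex_coeffSet hLam).set_average_mem isClosed_coeffSet ?_ hfin.ne
    (ae_mem_coeffSet hb hle) ((hb.1.mono_measure (Measure.restrict_mono_ae hle)).integrable le_top)
  -- The averaging set must have positive measure: every ball about a point of an element meets the
  -- interior of that element.
  have hxc : x ∈ closure (interior (hull s)) := by
    rw [(convex_convexHull ℝ _).closure_interior_eq_closure_of_nonempty_interior
      (interior_hull_nonempty (T.indep hs.1) hs.2)]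
    exact subset_closure hx
  have hne : (Metric.ball x δ ∩ interior (hull s)).Nonempty :=
    mem_closure_iff.1 hxc _ Metric.isOpen_ball (Metric.mem_ball_self hδ)
  refine (((Metric.isOpen_ball.inter isOpen_interior).measure_pos volume hne).trans_le
    (measure_mono (Set.inter_subset_inter_right _ ?_))).ne'
  exact interior_subset.trans (T.convexHull_subset_space hs.1)

theorem HybridMesh.measurableSet_Γ (M : HybridMesh n) : MeasurableSet M.Γ :=
  isClosed_frontier.measurableSet.diff isClosed_frontier.measurableSet

/-- The trace is a limit of averages lying in a closed convex set. The facet lies in Γ only up to a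
surface null set, which is discarded as well. -/
theorem ae_trace_mem_coeffSet {M : HybridMesh n} (hLam : 0 < Lam) (hb : b ∈ CoeffClass lam Lam D)
    (hK : T.space ≤ᵐ[volume] D) (hβ : IsTraceOn T.space M.Γ b β)
    {p : Finset (Pt n) × Finset (Pt n)} (hp : p ∈ M.facetSet T) :
    ∀ᵐ x ∂((surf n).restrict (hull p.2)), β x ∈ coeffSet n lam Lam := by
  rw [IsTraceOn, ae_restrict_iff' M.measurableSet_Γ] at hβ
  rw [ae_restrict_iff' (measurableSet_hull p.2)]
  filter_upwards [hβ, measure_eq_zero_iff_ae_notMem.1 hp.2.2.2] with x hx hxΓ hxp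
  have hxΓ' : x ∈ M.Γ := by
    by_contra h
    exact hxΓ ⟨hxp, h⟩
  refine isClosed_coeffSet.mem_of_tendsto (hx hxΓ') ?_
  filter_upwards [self_mem_nhdsWithin] with δ hδ
  exact average_mem_coeffSet hLam hb hK hp.1
    (convexHull_mono (Finset.coe_subset.2 hp.2.1) hxp) hδ

end Trace

/-! ### Facets on the interface -/

section Facets

variable {M : HybridMesh n} {T : Geometry.SimplicialComplex ℝ (Pt n)}

theorem HybridMesh.disjoint_interior_Th_Γ (M : HybridMesh n) :
    Disjoint (interior M.Th.space) M.Γ :=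
  Set.disjoint_left.2 fun _ hx hxΓ => hxΓ.1.2 hx

/-- Γ is defined through `K₁`, so this side needs an argument: a point of Γ belongs to an element of
`K₁` and is a limit of its interior points, so if it were interior to `K₂` the two interiors would
meet. -/
theorem HybridMesh.disjoint_interior_TH_Γ (M : HybridMesh n) :
    Disjoint (interior M.TH.space) M.Γ := by
  refine Set.disjoint_left.2 fun x hx hxΓ => ?_
  have hxK : x ∈ M.Th.space := (isCompact_space M.finite_Th).isClosed.frontier_subset hxΓ.1
  rw [space_eq_biUnion M.finite_Th M.pure_Th] at hxK
  simp only [Set.mem_iUnion] at hxK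
  obtain ⟨s, hs, hxs⟩ := hxK
  have hs := mem_elementFinset.1 hs
  have hxc : x ∈ closure (interior (hull s)) := by
    rw [(convex_convexHull ℝ _).closure_interior_eq_closure_of_nonempty_interior
      (interior_hull_nonempty (M.Th.indep hs.1) hs.2)]
    exact subset_closure hxs
  obtain ⟨y, hy, hys⟩ := mem_closure_iff.1 hxc _ isOpen_interior hx
  exact Set.disjoint_left.1 M.disjoint
    (interior_mono (M.Th.convexHull_subset_space hs.1) hys) hy

theorem facet_mem_faces (hn : 0 < n) {p : Finset (Pt n) × Finset (Pt n)}
    (hp : p ∈ M.facetSet T) : p.2 ∈ T.faces :=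
  T.down_closed hp.1.1 hp.2.1 (Finset.card_pos.1 (by rw [hp.2.2.1]; exact hn))

/-- Two different pairs have either different facets, which meet in lower dimension, or the same
facet with different elements. In the latter case the facet is null on Γ, being shared, and null off
Γ by membership in `facetSet`. -/
theorem surf_facet_inter_eq_zero (hn : 0 < n) (hT : Disjoint (interior T.space) M.Γ)
    {p q : Finset (Pt n) × Finset (Pt n)} (hp : p ∈ M.facetSet T) (hq : q ∈ M.facetSet T)
    (hpq : p ≠ q) : surf n (hull p.2 ∩ hull q.2) = 0 := by
  by_cases h2 : p.2 = q.2
  · have h1 : p.1 ≠ q.1 := fun h => hpq (Prod.ext h h2)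
    have h0 := surf_shared_facet hp.1 hq.1 h1 hp.2.1 (h2 ▸ hq.2.1) hp.2.2.1 hT
    refine measure_mono_null (fun x hx => ?_) (measure_union_null h0 hp.2.2.2)
    by_cases hxΓ : x ∈ M.Γ
    · exact Or.inl ⟨hx.1, hxΓ⟩
    · exact Or.inr ⟨hx.1, hxΓ⟩
  · exact surf_hull_inter_eq_zero (facet_mem_faces hn hp) (facet_mem_faces hn hq) hp.2.2.1
      hq.2.2.1 h2

theorem integrableOn_surf {E : Type*} [NormedAddCommGroup E] {S : Set (Pt n)} {g : Pt n → E}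
    (hS : IsCompact S) (hfin : surf n S < ⊤) (hg : ContinuousOn g S) :
    IntegrableOn g S (surf n) := by
  have : IsFiniteMeasure ((surf n).restrict S) := ⟨by simpa using hfin⟩
  obtain ⟨B, hB⟩ := hS.exists_bound_of_continuousOn hg
  exact Integrable.of_bound (hg.aestronglyMeasurable_of_isCompact hS hS.isClosed.measurableSet) B
    ((ae_restrict_iff' hS.isClosed.measurableSet).2 (Eventually.of_forall hB))

theorem memLp_two_surf {E : Type*} [NormedAddCommGroup E] {S : Set (Pt n)} {g : Pt n → E}
    (hS : IsCompact S) (hfin : surf n S < ⊤) (hg : ContinuousOn g S) :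
    MemLp g 2 ((surf n).restrict S) := by
  rw [memLp_two_iff_integrable_sq_norm (integrableOn_surf hS hfin hg).1]
  exact integrableOn_surf hS hfin (hg.norm.pow 2)

theorem l2Norm_sq {μ : Measure (Pt n)} {S : Set (Pt n)} {v : Pt n → ℝ} :
    l2Norm μ S v ^ 2 = ∫ x in S, v x ^ 2 ∂μ :=
  Real.sq_sqrt (integral_nonneg fun _ => sq_nonneg _)

theorem TraceIneq.integral_sq_le {r : ℕ} {C : ℝ} {s : Finset (Pt n)} {e : Set (Pt n)}
    (h : TraceIneq r C s e) {p : MvPolynomial (Fin n) ℝ} (hp : p.totalDegree ≤ r) :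
    meshSize s * ∫ x in e, polyFun p x ^ 2 ∂(surf n) ≤ C ^ 2 * ∫ x in hull s, polyFun p x ^ 2 := by
  have h0 : 0 ≤ l2Norm (surf n) e (polyFun p) := Real.sqrt_nonneg _
  have h1 := pow_le_pow_left₀ h0 (h p hp) 2
  rw [mul_pow, mul_pow, l2Norm_sq, l2Norm_sq, inv_pow, Real.sq_sqrt (meshSize_nonneg s)] at h1
  have hI : 0 ≤ ∫ x in hull s, polyFun p x ^ 2 := integral_nonneg fun _ => sq_nonneg _
  rcases (meshSize_nonneg s).eq_or_lt with h0 | h0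
  · rw [← h0, zero_mul]
    positivity
  · calc meshSize s * ∫ x in e, polyFun p x ^ 2 ∂(surf n)
        ≤ meshSize s * (C ^ 2 * (meshSize s)⁻¹ * ∫ x in hull s, polyFun p x ^ 2) := by
          gcongr
      _ = _ := by field_simp

/-- The trace inequality is applied to each partial derivative and the squares are summed, so the
constant is the same as for scalars. -/
theorem TraceIneq.integral_norm_sq_polyGrad_le {r : ℕ} {C : ℝ} {s : Finset (Pt n)}
    {e : Set (Pt n)} (h : TraceIneq r C s e) (he : IsCompact e) (hfin : surf n e < ⊤)
    {p : MvPolynomial (Fin n) ℝ} (hp : p.totalDegree ≤ r) :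
    meshSize s * ∫ x in e, ‖polyGrad p x‖ ^ 2 ∂(surf n)
      ≤ C ^ 2 * ∫ x in hull s, ‖polyGrad p x‖ ^ 2 := by
  have hc : ∀ i, Continuous fun x => polyFun (MvPolynomial.pderiv i p) x ^ 2 := fun i =>
    (continuous_polyFun _).pow 2
  simp only [norm_sq_polyGrad]
  rw [integral_finsetSum _ fun i _ => integrableOn_surf he hfin (hc i).continuousOn,
    integral_finsetSum _ fun i _ => integrableOn_hull (hc i) s, Finset.mul_sum, Finset.mul_sum]
  exact Finset.sum_le_sum fun i _ => h.integral_sq_le (totalDegree_pderiv_le_of_le hp i)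

variable {F : Finset (Finset (Pt n) × Finset (Pt n))} {r : ℕ} {C : ℝ}

theorem surf_facet_lt_top (hn : 0 < n) {p : Finset (Pt n) × Finset (Pt n)}
    (hp : p ∈ M.facetSet T) : surf n (hull p.2) < ⊤ :=
  surf_hull_lt_top (T.indep (facet_mem_faces hn hp)) hp.2.2.1 hn

theorem facetUnion_eq_biUnion (s : Finset (Pt n)) [DecidableEq (Finset (Pt n))] :
    facetUnion F s = ⋃ p ∈ F.filter (fun p => p.1 = s), hull p.2 := by
  ext x
  simp only [facetUnion, Set.mem_iUnion, Finset.mem_filter, Set.mem_ofPred_eq]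
  constructor
  · rintro ⟨f, hf, hx⟩
    exact ⟨(s, f), ⟨hf, rfl⟩, hx⟩
  · rintro ⟨⟨s', f⟩, ⟨hf, rfl⟩, hx⟩
    exact ⟨f, hf, hx⟩

/-- The inverse trace inequality for the gradient, summed over the facets of one element that lie
on the interface. -/
theorem sum_facets_le (hn : 0 < n) (hTΓ : Disjoint (interior T.space) M.Γ)
    (hF : ∀ p ∈ F, p ∈ M.facetSet T) {s : Finset (Pt n)}
    (hC1 : ∀ f ⊆ s, f.card = n → TraceIneq r C s (hull f))
    (hC2 : 2 < Set.ncard {f | (s, f) ∈ F} → TraceIneq r C s (facetUnion F s))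
    [DecidableEq (Finset (Pt n))] {p : MvPolynomial (Fin n) ℝ} (hp : p.totalDegree ≤ r) :
    meshSize s * ∑ q ∈ F.filter (fun q => q.1 = s), ∫ x in hull q.2, ‖polyGrad p x‖ ^ 2 ∂(surf n)
      ≤ 2 * C ^ 2 * ∫ x in hull s, ‖polyGrad p x‖ ^ 2 := by
  have hI : 0 ≤ ∫ x in hull s, ‖polyGrad p x‖ ^ 2 := integral_nonneg fun _ => sq_nonneg _
  set E := F.filter (fun q => q.1 = s) with hE
  have hEF : ∀ q ∈ E, q ∈ M.facetSet T ∧ q.1 = s := fun q hq =>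
    ⟨hF q (Finset.mem_filter.1 hq).1, (Finset.mem_filter.1 hq).2⟩
  have hcont : Continuous fun x => ‖polyGrad p x‖ ^ 2 := (continuous_polyGrad p).norm.pow 2
  have hcard : Set.ncard {f | (s, f) ∈ F} = E.card := by
    have h1 : (E : Set (Finset (Pt n) × Finset (Pt n)))
        = (fun f => (s, f)) '' {f | (s, f) ∈ F} := by
      ext ⟨s', f⟩
      simp only [hE, Finset.coe_filter, Set.mem_ofPred_eq, Set.mem_image, Prod.mk.injEq]
      constructor
      · rintro ⟨h, rfl⟩
        exact ⟨f, h, rfl, rfl⟩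
      · rintro ⟨f', h, rfl, rfl⟩
        exact ⟨h, rfl⟩
    rw [← Set.ncard_coe_finset, h1, Set.ncard_image_of_injective _ (Prod.mk_right_injective s)]
  -- With at most two facets each one costs C², which produces the factor 2; with more, the
  -- inequality for their union costs C² only once.
  rcases le_or_gt E.card 2 with h2 | h2
  · rw [Finset.mul_sum]
    calc ∑ q ∈ E, meshSize s * ∫ x in hull q.2, ‖polyGrad p x‖ ^ 2 ∂(surf n)
        ≤ ∑ _q ∈ E, C ^ 2 * ∫ x in hull s, ‖polyGrad p x‖ ^ 2 := by
          refine Finset.sum_le_sum fun q hq => ?_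
          obtain ⟨hq1, hq2⟩ := hEF q hq
          refine (hC1 q.2 ?_ hq1.2.2.1).integral_norm_sq_polyGrad_le (isCompact_hull _)
            (surf_facet_lt_top hn hq1) hp
          rw [← hq2]
          exact hq1.2.1
      _ = E.card * (C ^ 2 * ∫ x in hull s, ‖polyGrad p x‖ ^ 2) := by
          rw [Finset.sum_const, nsmul_eq_mul]
      _ ≤ 2 * (C ^ 2 * ∫ x in hull s, ‖polyGrad p x‖ ^ 2) := by
          have : (E.card : ℝ) ≤ 2 := by exact_mod_cast h2
          gcongr
      _ = _ := by ring
  · have hU := hC2 (hcard ▸ h2)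
    rw [facetUnion_eq_biUnion] at hU
    have hcomp : IsCompact (⋃ q ∈ E, hull q.2) := E.isCompact_biUnion fun q _ => isCompact_hull _
    have hfin : surf n (⋃ q ∈ E, hull q.2) < ⊤ :=
      (measure_biUnion_finset_le _ _).trans_lt
        (ENNReal.sum_lt_top.2 fun q hq => surf_facet_lt_top hn (hEF q hq).1)
    have h3 := hU.integral_norm_sq_polyGrad_le hcomp hfin hp
    rw [setIntegral_biUnion_finset_eq_sum E (fun q _ => measurableSet_hull q.2)
      (fun q hq q' hq' => surf_facet_inter_eq_zero hn hTΓ (hEF q hq).1 (hEF q' hq').1)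
      (fun q hq => integrableOn_surf (isCompact_hull _) (surf_facet_lt_top hn (hEF q hq).1)
        hcont.continuousOn)] at h3
    refine h3.trans ?_
    nlinarith [mul_nonneg (sq_nonneg C) hI]

/-- Grouping the facets by their element reduces the sum to the bound on a single element. -/
theorem sum_interface_facets_le (hn : 0 < n) (hTΓ : Disjoint (interior T.space) M.Γ)
    (hT : T.faces.Finite) (hpure : ∀ f ∈ T.faces, ∃ s ∈ elements T, f ⊆ s)
    (hF : ∀ p ∈ F, p ∈ M.facetSet T)
    (hC1 : ∀ s ∈ elements T, ∀ f ⊆ s, f.card = n → TraceIneq r C s (hull f))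
    (hC2 : ∀ s ∈ elements T, 2 < Set.ncard {f | (s, f) ∈ F} → TraceIneq r C s (facetUnion F s))
    {v : Pt n → ℝ} {P : Finset (Pt n) → MvPolynomial (Fin n) ℝ} (hP : IsPieces r T v P) :
    ∑ q ∈ F, meshSize q.1 * ∫ x in hull q.2, ‖polyGrad (P q.1) x‖ ^ 2 ∂(surf n)
      ≤ 2 * C ^ 2 * ∫ x in T.space, ‖gradient v x‖ ^ 2 := by
  classical
  rw [hP.integral_sq_gradient hT hpure, Finset.mul_sum,
    ← Finset.sum_fiberwise_of_maps_to (t := elementFinset hT) (g := Prod.fst)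
      (fun q hq => mem_elementFinset.2 (hF q hq).1)]
  refine Finset.sum_le_sum fun s hs => ?_
  have hs := mem_elementFinset.1 hs
  refine le_trans (le_of_eq ?_) (sum_facets_le hn hTΓ hF (hC1 s hs) (hC2 s hs) (hP s hs).1)
  rw [Finset.mul_sum]
  refine Finset.sum_congr rfl fun q hq => ?_
  rw [(Finset.mem_filter.1 hq).2]

end Facets

/-! ### Bounds for the interface terms -/

/-- This is the only property of the normal that the estimates require. -/
theorem norm_outwardNormal_le (s f : Finset (Pt n)) : ‖outwardNormal s f‖ ≤ 1 := by
  simp only [outwardNormal]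
  rw [norm_smul, norm_inv, norm_norm]
  exact inv_mul_le_one

/-- Cauchy–Schwarz on one piece. A pointwise bound on `f` suffices, without measurability, so none
has to be established for the traces of the coefficient. -/
theorem abs_setIntegral_flux_le {S : Set (Pt n)} (hS : IsCompact S) (hfin : surf n S < ⊤)
    {G₁ G₂ : Pt n → Pt n} (hG₁ : Continuous G₁) (hG₂ : Continuous G₂) {u f : Pt n → ℝ}
    (hu : ContinuousOn u S) {L α₁ α₂ : ℝ} (hL : 0 ≤ L) (h₁ : 0 ≤ α₁) (h₂ : 0 ≤ α₂)
    (hf : ∀ᵐ x ∂((surf n).restrict S), |f x| ≤ L * (α₁ * ‖G₁ x‖ + α₂ * ‖G₂ x‖) * |u x|) :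
    |∫ x in S, f x ∂(surf n)| ≤ L * (α₁ * √(∫ x in S, ‖G₁ x‖ ^ 2 ∂(surf n))
      + α₂ * √(∫ x in S, ‖G₂ x‖ ^ 2 ∂(surf n))) * l2Norm (surf n) S u := by
  have m₁ : MemLp (fun x => ‖G₁ x‖) 2 ((surf n).restrict S) :=
    (memLp_two_surf hS hfin hG₁.continuousOn).norm
  have m₂ : MemLp (fun x => ‖G₂ x‖) 2 ((surf n).restrict S) :=
    (memLp_two_surf hS hfin hG₂.continuousOn).norm
  have mu : MemLp (fun x => |u x|) 2 ((surf n).restrict S) := (memLp_two_surf hS hfin hu).norm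
  have i₁ : Integrable (fun x => ‖G₁ x‖ * |u x|) ((surf n).restrict S) := m₁.integrable_mul mu
  have i₂ : Integrable (fun x => ‖G₂ x‖ * |u x|) ((surf n).restrict S) := m₂.integrable_mul mu
  have c₁ := integral_mul_le_sqrt_mul_sqrt m₁ mu (fun _ => norm_nonneg _) fun _ => abs_nonneg _
  have c₂ := integral_mul_le_sqrt_mul_sqrt m₂ mu (fun _ => norm_nonneg _) fun _ => abs_nonneg _
  simp only [sq_abs] at c₁ c₂
  have hdom : Integrable (fun x => L * (α₁ * (‖G₁ x‖ * |u x|) + α₂ * (‖G₂ x‖ * |u x|)))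
      ((surf n).restrict S) := ((i₁.const_mul α₁).add (i₂.const_mul α₂)).const_mul L
  rw [← Real.norm_eq_abs]
  refine (norm_integral_le_of_norm_le hdom ?_).trans ?_
  · filter_upwards [hf] with x hx
    rw [Real.norm_eq_abs]
    exact hx.trans (le_of_eq (by ring))
  · rw [integral_const_mul, integral_add (i₁.const_mul α₁) (i₂.const_mul α₂), integral_const_mul,
      integral_const_mul, mul_assoc, add_mul, mul_assoc, mul_assoc]
    unfold l2Norm
    gcongr

namespace HybridMesh

variable {M : HybridMesh n}

theorem mem_Eh {p : Finset (Pt n) × Finset (Pt n)} : p ∈ M.Eh ↔ p ∈ M.facetSet M.Th := by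
  simp [Eh]

theorem mem_EH {p : Finset (Pt n) × Finset (Pt n)} : p ∈ M.EH ↔ p ∈ M.facetSet M.TH := by
  simp [EH]

/-- The weighted square sum of the jumps, that is, the penalty term for the penalty `γ = 1`. -/
def jumpSq (M : HybridMesh n) (w : (Pt n → ℝ) × (Pt n → ℝ)) : ℝ :=
  ∑ p ∈ M.Eh, ∑ q ∈ M.EH, l2Norm (surf n) (cap p q) (fun x => w.1 x - w.2 x) ^ 2
    / (meshSize p.1 + meshSize q.1)

/-- The square of the broken `L²` norm of the gradient. -/
def gradSq (M : HybridMesh n) (v : (Pt n → ℝ) × (Pt n → ℝ)) : ℝ :=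
  (∫ x in M.K₁, ‖gradient v.1 x‖ ^ 2) + ∫ x in M.K₂, ‖gradient v.2 x‖ ^ 2

theorem jumpSq_nonneg (w : (Pt n → ℝ) × (Pt n → ℝ)) : 0 ≤ M.jumpSq w :=
  Finset.sum_nonneg fun _ _ => Finset.sum_nonneg fun _ _ =>
    div_nonneg (sq_nonneg _) (add_nonneg (meshSize_nonneg _) (meshSize_nonneg _))

theorem gradSq_nonneg (v : (Pt n → ℝ) × (Pt n → ℝ)) : 0 ≤ M.gradSq v :=
  add_nonneg (integral_nonneg fun _ => sq_nonneg _) (integral_nonneg fun _ => sq_nonneg _)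

theorem brokenNorm_sq {γ : ℝ} (hγ : 0 ≤ γ) (v : (Pt n → ℝ) × (Pt n → ℝ)) :
    M.brokenNorm γ v ^ 2 = M.gradSq v + γ * M.jumpSq v := by
  have h : M.brokenNorm γ v = √(M.gradSq v + γ * M.jumpSq v) := by
    rw [brokenNorm, gradSq, jumpSq]
    congr 2
    rw [Finset.mul_sum]
    refine Finset.sum_congr rfl fun p _ => ?_
    rw [Finset.mul_sum]
    refine Finset.sum_congr rfl fun q _ => ?_
    rw [add_comm (meshSize q.1)]
    ring
  rw [h, Real.sq_sqrt]
  exact add_nonneg (gradSq_nonneg v) (mul_nonneg hγ (jumpSq_nonneg v))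

theorem isCompact_cap (p q : Finset (Pt n) × Finset (Pt n)) : IsCompact (cap p q) :=
  (isCompact_hull _).inter (isCompact_hull _)

theorem surf_cap_lt_top (hn : 0 < n) {p : Finset (Pt n) × Finset (Pt n)} (hp : p ∈ M.Eh)
    (q : Finset (Pt n) × Finset (Pt n)) : surf n (cap p q) < ⊤ :=
  (measure_mono Set.inter_subset_left).trans_lt (surf_facet_lt_top hn (mem_Eh.1 hp))

theorem cap_subset_left {p q : Finset (Pt n) × Finset (Pt n)} (hp : p ∈ M.Eh) :
    cap p q ⊆ hull p.1 :=
  Set.inter_subset_left.trans (convexHull_mono (Finset.coe_subset.2 (mem_Eh.1 hp).2.1))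

theorem cap_subset_right {p q : Finset (Pt n) × Finset (Pt n)} (hq : q ∈ M.EH) :
    cap p q ⊆ hull q.1 :=
  Set.inter_subset_right.trans (convexHull_mono (Finset.coe_subset.2 (mem_EH.1 hq).2.1))

theorem continuousOn_jump {r : ℕ} {w : (Pt n → ℝ) × (Pt n → ℝ)}
    (hw : w ∈ FESpace r M.Th ×ˢ FESpace r M.TH) {p q : Finset (Pt n) × Finset (Pt n)}
    (hp : p ∈ M.Eh) (hq : q ∈ M.EH) : ContinuousOn (fun x => w.1 x - w.2 x) (cap p q) :=
  (hw.1.1.mono ((cap_subset_left hp).trans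
    (M.Th.convexHull_subset_space (mem_Eh.1 hp).1.1))).sub
    (hw.2.1.mono ((cap_subset_right hq).trans
      (M.TH.convexHull_subset_space (mem_EH.1 hq).1.1)))

theorem meshSize_pos_of_mem_Eh (hn : 0 < n) {p : Finset (Pt n) × Finset (Pt n)}
    (hp : p ∈ M.Eh) : 0 < meshSize p.1 :=
  meshSize_pos (by rw [(mem_Eh.1 hp).1.2]; omega)

/-- The gradients on the two sides of the interface, weighted with the mesh sizes, are controlled
by the broken gradient norm. -/
theorem sum_cap_gradient_le (hn : 0 < n) {r : ℕ} {C : ℝ} (hC : M.IsTraceConst r C)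
    {v : (Pt n → ℝ) × (Pt n → ℝ)} {P₁ P₂ : Finset (Pt n) → MvPolynomial (Fin n) ℝ}
    (hP₁ : IsPieces r M.Th v.1 P₁) (hP₂ : IsPieces r M.TH v.2 P₂) :
    ∑ p ∈ M.Eh, ∑ q ∈ M.EH,
      (meshSize p.1 * ∫ x in cap p q, ‖polyGrad (P₁ p.1) x‖ ^ 2 ∂(surf n)
        + meshSize q.1 * ∫ x in cap p q, ‖polyGrad (P₂ q.1) x‖ ^ 2 ∂(surf n))
      ≤ 2 * C ^ 2 * M.gradSq v := by
  have hcont : ∀ p : MvPolynomial (Fin n) ℝ, Continuous fun x => ‖polyGrad p x‖ ^ 2 := fun p =>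
    (continuous_polyGrad p).norm.pow 2
  have hmeas : ∀ p q : Finset (Pt n) × Finset (Pt n), MeasurableSet (cap p q) := fun p q =>
    (isCompact_cap p q).isClosed.measurableSet
  have h₁ : ∑ p ∈ M.Eh, ∑ q ∈ M.EH,
      meshSize p.1 * ∫ x in cap p q, ‖polyGrad (P₁ p.1) x‖ ^ 2 ∂(surf n)
      ≤ 2 * C ^ 2 * ∫ x in M.K₁, ‖gradient v.1 x‖ ^ 2 := by
    refine le_trans (Finset.sum_le_sum fun p hp => ?_)
      (sum_interface_facets_le hn M.disjoint_interior_Th_Γ M.finite_Th M.pure_Th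
        (F := M.Eh) (fun p hp => mem_Eh.1 hp) (fun s hs => hC.1 s (Or.inl hs))
        (fun s hs => hC.2 M.Eh (Or.inl rfl) s (Or.inl hs)) hP₁)
    -- For a fixed facet of one mesh, its intersections with the facets of the other are almost
    -- disjoint subsets of it.
    rw [← Finset.mul_sum]
    refine mul_le_mul_of_nonneg_left ?_ (meshSize_nonneg _)
    refine sum_setIntegral_le M.EH (fun q _ => hmeas p q) (fun q hq q' hq' hne => ?_)
      (fun q _ => Set.inter_subset_left)
      (integrableOn_surf (isCompact_hull _) (surf_facet_lt_top hn (mem_Eh.1 hp))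
        (hcont _).continuousOn) fun _ => sq_nonneg _
    exact measure_mono_null (Set.inter_subset_inter Set.inter_subset_right Set.inter_subset_right)
      (surf_facet_inter_eq_zero hn M.disjoint_interior_TH_Γ (mem_EH.1 hq) (mem_EH.1 hq') hne)
  have h₂ : ∑ q ∈ M.EH, ∑ p ∈ M.Eh,
      meshSize q.1 * ∫ x in cap p q, ‖polyGrad (P₂ q.1) x‖ ^ 2 ∂(surf n)
      ≤ 2 * C ^ 2 * ∫ x in M.K₂, ‖gradient v.2 x‖ ^ 2 := by
    refine le_trans (Finset.sum_le_sum fun q hq => ?_)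
      (sum_interface_facets_le hn M.disjoint_interior_TH_Γ M.finite_TH M.pure_TH
        (F := M.EH) (fun p hp => mem_EH.1 hp) (fun s hs => hC.1 s (Or.inr hs))
        (fun s hs => hC.2 M.EH (Or.inr rfl) s (Or.inr hs)) hP₂)
    rw [← Finset.mul_sum]
    refine mul_le_mul_of_nonneg_left ?_ (meshSize_nonneg _)
    refine sum_setIntegral_le M.Eh (fun p _ => hmeas p q) (fun p hp p' hp' hne => ?_)
      (fun p _ => Set.inter_subset_right)
      (integrableOn_surf (isCompact_hull _) (surf_facet_lt_top hn (mem_EH.1 hq))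
        (hcont _).continuousOn) fun _ => sq_nonneg _
    exact measure_mono_null (Set.inter_subset_inter Set.inter_subset_left Set.inter_subset_left)
      (surf_facet_inter_eq_zero hn M.disjoint_interior_Th_Γ (mem_Eh.1 hp) (mem_Eh.1 hp') hne)
  rw [Finset.sum_comm] at h₂
  simp only [Finset.sum_add_distrib]
  rw [gradSq, mul_add]
  exact add_le_add h₁ h₂

theorem sum_sqrt_mul_sqrt_le {F E : Finset (Finset (Pt n) × Finset (Pt n))}
    {A B : Finset (Pt n) × Finset (Pt n) → Finset (Pt n) × Finset (Pt n) → ℝ}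
    (hA : ∀ p ∈ F, ∀ q ∈ E, 0 ≤ A p q) (hB : ∀ p ∈ F, ∀ q ∈ E, 0 ≤ B p q) :
    ∑ p ∈ F, ∑ q ∈ E, √(A p q) * √(B p q)
      ≤ √(∑ p ∈ F, ∑ q ∈ E, A p q) * √(∑ p ∈ F, ∑ q ∈ E, B p q) := by
  have h := Finset.sum_mul_sq_le_sq_mul_sq (F ×ˢ E) (fun z => √(A z.1 z.2)) fun z => √(B z.1 z.2)
  have hA' : ∑ z ∈ F ×ˢ E, √(A z.1 z.2) ^ 2 = ∑ p ∈ F, ∑ q ∈ E, A p q := by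
    rw [Finset.sum_product]
    exact Finset.sum_congr rfl fun p hp => Finset.sum_congr rfl fun q hq =>
      Real.sq_sqrt (hA p hp q hq)
  have hB' : ∑ z ∈ F ×ˢ E, √(B z.1 z.2) ^ 2 = ∑ p ∈ F, ∑ q ∈ E, B p q := by
    rw [Finset.sum_product]
    exact Finset.sum_congr rfl fun p hp => Finset.sum_congr rfl fun q hq =>
      Real.sq_sqrt (hB p hp q hq)
  rw [hA', hB', Finset.sum_product] at h
  rw [← Real.sqrt_mul (Finset.sum_nonneg fun p hp => Finset.sum_nonneg fun q hq => hA p hp q hq)]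
  exact Real.le_sqrt_of_sq_le h

/-- By convexity of the square, (hx + Hy)² ≤ (h + H)(hx² + Hy²). The weights thus give each gradient
its own mesh size, as the trace inequality requires, and leave the jump with the penalty weight 1/(h
+ H). -/
theorem weighted_mul_le {h H g₁ g₂ l : ℝ} (hh : 0 < h) (hH : 0 ≤ H) (hg₁ : 0 ≤ g₁)
    (hg₂ : 0 ≤ g₂) :
    (h / (h + H) * √g₁ + H / (h + H) * √g₂) * l ≤ √(h * g₁ + H * g₂) * √(l ^ 2 / (h + H)) := by
  rw [← Real.sqrt_mul (by positivity)]
  refine Real.le_sqrt_of_sq_le ?_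
  have e₁ := Real.sq_sqrt hg₁
  have e₂ := Real.sq_sqrt hg₂
  set x := √g₁
  set y := √g₂
  have hs : 0 < h + H := by linarith
  have hkey : (h * x + H * y) ^ 2 ≤ (h + H) * (h * g₁ + H * g₂) := by
    rw [← e₁, ← e₂]
    nlinarith [mul_nonneg (mul_nonneg hh.le hH) (sq_nonneg (x - y))]
  calc ((h / (h + H) * x + H / (h + H) * y) * l) ^ 2
      = (h * x + H * y) ^ 2 * (l ^ 2 / (h + H) ^ 2) := by field_simp
    _ ≤ (h + H) * (h * g₁ + H * g₂) * (l ^ 2 / (h + H) ^ 2) := by gcongr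
    _ = _ := by field_simp

/-- Only a norm bound on the coefficients enters, so the estimate serves both flux terms, with the
traces and with their adjoints. -/
theorem abs_fluxTerm_le (hn : 0 < n) {r : ℕ} {C : ℝ} (hC : M.IsTraceConst r C) (hLam : 0 ≤ Lam)
    {a₁ a₂ : Pt n → (Pt n →L[ℝ] Pt n)}
    (ha₁ : ∀ p ∈ M.Eh, ∀ᵐ x ∂((surf n).restrict (hull p.2)), ‖a₁ x‖ ≤ Lam)
    (ha₂ : ∀ q ∈ M.EH, ∀ᵐ x ∂((surf n).restrict (hull q.2)), ‖a₂ x‖ ≤ Lam)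
    {v w : (Pt n → ℝ) × (Pt n → ℝ)} (hv : v ∈ FESpace r M.Th ×ˢ FESpace r M.TH)
    (hw : w ∈ FESpace r M.Th ×ˢ FESpace r M.TH) :
    |M.fluxTerm a₁ a₂ v w| ≤ Lam * (√(2 * C ^ 2 * M.gradSq v) * √(M.jumpSq w)) := by
  obtain ⟨P₁, hP₁⟩ := exists_isPieces hv.1
  obtain ⟨P₂, hP₂⟩ := exists_isPieces hv.2
  have hpair : ∀ p ∈ M.Eh, ∀ q ∈ M.EH, |∫ x in cap p q,
      wavg p.1 q.1
        (inner ℝ (a₁ x (gradientWithin v.1 (hull p.1) x)) (outwardNormal p.1 p.2))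
        (inner ℝ (a₂ x (gradientWithin v.2 (hull q.1) x)) (outwardNormal p.1 p.2))
      * (w.1 x - w.2 x) ∂(surf n)| ≤
      Lam * (√(meshSize p.1 * ∫ x in cap p q, ‖polyGrad (P₁ p.1) x‖ ^ 2 ∂(surf n)
        + meshSize q.1 * ∫ x in cap p q, ‖polyGrad (P₂ q.1) x‖ ^ 2 ∂(surf n))
      * √(l2Norm (surf n) (cap p q) (fun x => w.1 x - w.2 x) ^ 2
          / (meshSize p.1 + meshSize q.1))) := by
    intro p hp q hq
    have hh := meshSize_pos_of_mem_Eh hn hp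
    have hH := meshSize_nonneg q.1
    have hbound := abs_setIntegral_flux_le (isCompact_cap p q) (surf_cap_lt_top hn hp q)
      (continuous_polyGrad (P₁ p.1)) (continuous_polyGrad (P₂ q.1)) (continuousOn_jump hw hp hq)
      (f := fun x => wavg p.1 q.1
        (inner ℝ (a₁ x (gradientWithin v.1 (hull p.1) x)) (outwardNormal p.1 p.2))
        (inner ℝ (a₂ x (gradientWithin v.2 (hull q.1) x)) (outwardNormal p.1 p.2))
      * (w.1 x - w.2 x)) (L := Lam) (α₁ := meshSize p.1 / (meshSize p.1 + meshSize q.1))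
      (α₂ := meshSize q.1 / (meshSize p.1 + meshSize q.1)) hLam (by positivity) (by positivity) ?_
    · refine hbound.trans ?_
      rw [mul_assoc]
      refine mul_le_mul_of_nonneg_left ?_ hLam
      exact weighted_mul_le hh hH (integral_nonneg fun _ => sq_nonneg _)
        (integral_nonneg fun _ => sq_nonneg _)
    · filter_upwards [ae_restrict_of_ae_restrict_of_subset (s := cap p q) Set.inter_subset_left
          (ha₁ p hp), ae_restrict_of_ae_restrict_of_subset (s := cap p q) Set.inter_subset_right
          (ha₂ q hq), ae_restrict_mem (isCompact_cap p q).isClosed.measurableSet] with x h1 h2 hx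
      rw [hP₁.gradientWithin_eq (mem_Eh.1 hp).1 (cap_subset_left hp hx),
        hP₂.gradientWithin_eq (mem_EH.1 hq).1 (cap_subset_right hq hx), abs_mul]
      refine mul_le_mul_of_nonneg_right ?_ (abs_nonneg _)
      have hinner : ∀ (A : Pt n →L[ℝ] Pt n) (ξ : Pt n), ‖A‖ ≤ Lam →
          |inner ℝ (A ξ) (outwardNormal p.1 p.2)| ≤ Lam * ‖ξ‖ := by
        intro A ξ hA
        calc |inner ℝ (A ξ) (outwardNormal p.1 p.2)|
            ≤ ‖A ξ‖ * ‖outwardNormal p.1 p.2‖ := abs_real_inner_le_norm _ _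
          _ ≤ ‖A ξ‖ * 1 := by gcongr; exact norm_outwardNormal_le _ _
          _ ≤ Lam * ‖ξ‖ := by
              rw [mul_one]
              exact (A.le_opNorm ξ).trans (by gcongr)
      rw [wavg]
      refine (abs_add_le _ _).trans ?_
      rw [abs_mul, abs_mul, abs_of_nonneg (show 0 ≤ meshSize p.1 / (meshSize p.1 + meshSize q.1) by
        positivity), abs_of_nonneg (show 0 ≤ meshSize q.1 / (meshSize p.1 + meshSize q.1) by
        positivity)]
      calc _ ≤ meshSize p.1 / (meshSize p.1 + meshSize q.1) * (Lam * ‖polyGrad (P₁ p.1) x‖)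
            + meshSize q.1 / (meshSize p.1 + meshSize q.1) * (Lam * ‖polyGrad (P₂ q.1) x‖) := by
            gcongr
            · exact hinner _ _ h1
            · exact hinner _ _ h2
        _ = _ := by ring
  calc |M.fluxTerm a₁ a₂ v w|
      ≤ ∑ p ∈ M.Eh, ∑ q ∈ M.EH,
        Lam * (√(meshSize p.1 * ∫ x in cap p q, ‖polyGrad (P₁ p.1) x‖ ^ 2 ∂(surf n)
          + meshSize q.1 * ∫ x in cap p q, ‖polyGrad (P₂ q.1) x‖ ^ 2 ∂(surf n))
        * √(l2Norm (surf n) (cap p q) (fun x => w.1 x - w.2 x) ^ 2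
            / (meshSize p.1 + meshSize q.1))) := by
        rw [fluxTerm]
        refine (Finset.abs_sum_le_sum_abs _ _).trans (Finset.sum_le_sum fun p hp => ?_)
        exact (Finset.abs_sum_le_sum_abs _ _).trans (Finset.sum_le_sum fun q hq => hpair p hp q hq)
    _ ≤ Lam * (√(2 * C ^ 2 * M.gradSq v) * √(M.jumpSq w)) := by
        simp only [← Finset.mul_sum]
        refine mul_le_mul_of_nonneg_left ?_ hLam
        refine (sum_sqrt_mul_sqrt_le (fun p _ q _ => ?_) fun p _ q _ => ?_).trans ?_
        · exact add_nonneg (mul_nonneg (meshSize_nonneg _) (integral_nonneg fun _ => sq_nonneg _))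
            (mul_nonneg (meshSize_nonneg _) (integral_nonneg fun _ => sq_nonneg _))
        · exact div_nonneg (sq_nonneg _) (add_nonneg (meshSize_nonneg _) (meshSize_nonneg _))
        · rw [jumpSq]
          gcongr
          exact sum_cap_gradient_le hn hC hP₁ hP₂

theorem penaltyTerm_self (γ : ℝ) (v : (Pt n → ℝ) × (Pt n → ℝ)) :
    M.penaltyTerm γ v v = γ * M.jumpSq v := by
  rw [penaltyTerm, jumpSq, Finset.mul_sum]
  refine Finset.sum_congr rfl fun p _ => ?_
  rw [Finset.mul_sum]
  refine Finset.sum_congr rfl fun q _ => ?_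
  rw [l2Norm_sq, add_comm (meshSize q.1)]
  simp only [mul_assoc]
  rw [integral_const_mul]
  simp only [← sq]
  ring

theorem abs_penaltyTerm_le (hn : 0 < n) {r : ℕ} {γ : ℝ} (hγ : 0 ≤ γ)
    {v w : (Pt n → ℝ) × (Pt n → ℝ)} (hv : v ∈ FESpace r M.Th ×ˢ FESpace r M.TH)
    (hw : w ∈ FESpace r M.Th ×ˢ FESpace r M.TH) :
    |M.penaltyTerm γ v w| ≤ γ * (√(M.jumpSq v) * √(M.jumpSq w)) := by
  have hpair : ∀ p ∈ M.Eh, ∀ q ∈ M.EH, |∫ x in cap p q,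
      γ / (meshSize q.1 + meshSize p.1) * (v.1 x - v.2 x) * (w.1 x - w.2 x) ∂(surf n)| ≤
      γ * (√(l2Norm (surf n) (cap p q) (fun x => v.1 x - v.2 x) ^ 2
          / (meshSize p.1 + meshSize q.1))
        * √(l2Norm (surf n) (cap p q) (fun x => w.1 x - w.2 x) ^ 2
          / (meshSize p.1 + meshSize q.1))) := by
    intro p hp q hq
    have hh := meshSize_pos_of_mem_Eh hn hp
    have hH := meshSize_nonneg q.1
    have hs : 0 < meshSize p.1 + meshSize q.1 := by linarith
    have mv := (memLp_two_surf (isCompact_cap p q) (surf_cap_lt_top hn hp q)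
      (continuousOn_jump hv hp hq)).norm
    have mw := (memLp_two_surf (isCompact_cap p q) (surf_cap_lt_top hn hp q)
      (continuousOn_jump hw hp hq)).norm
    have hcs := integral_mul_le_sqrt_mul_sqrt mv mw (fun _ => norm_nonneg _) fun _ => norm_nonneg _
    simp only [Real.norm_eq_abs, sq_abs] at hcs
    simp only [mul_assoc]
    rw [integral_const_mul, abs_mul, abs_of_nonneg (by positivity)]
    have h1 : |∫ x in cap p q, (v.1 x - v.2 x) * (w.1 x - w.2 x) ∂(surf n)| ≤
        l2Norm (surf n) (cap p q) (fun x => v.1 x - v.2 x)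
        * l2Norm (surf n) (cap p q) (fun x => w.1 x - w.2 x) := by
      rw [← Real.norm_eq_abs]
      refine le_trans (norm_integral_le_integral_norm _) (le_trans (le_of_eq ?_) hcs)
      refine integral_congr_ae (Eventually.of_forall fun x => ?_)
      simp
    set lv := l2Norm (surf n) (cap p q) (fun x => v.1 x - v.2 x)
    set lw := l2Norm (surf n) (cap p q) (fun x => w.1 x - w.2 x)
    have hlv : 0 ≤ lv := Real.sqrt_nonneg _
    have hlw : 0 ≤ lw := Real.sqrt_nonneg _
    have h2 : √(lv ^ 2 / (meshSize p.1 + meshSize q.1)) * √(lw ^ 2 / (meshSize p.1 + meshSize q.1))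
        = lv * lw / (meshSize p.1 + meshSize q.1) := by
      rw [← Real.sqrt_mul (by positivity)]
      rw [show lv ^ 2 / (meshSize p.1 + meshSize q.1) * (lw ^ 2 / (meshSize p.1 + meshSize q.1))
        = (lv * lw / (meshSize p.1 + meshSize q.1)) ^ 2 by field_simp]
      exact Real.sqrt_sq (by positivity)
    rw [h2, add_comm (meshSize q.1)]
    calc γ / (meshSize p.1 + meshSize q.1) * |_|
        ≤ γ / (meshSize p.1 + meshSize q.1) * (lv * lw) := by gcongr
      _ = _ := by ring
  calc |M.penaltyTerm γ v w| ≤ ∑ p ∈ M.Eh, ∑ q ∈ M.EH,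
        γ * (√(l2Norm (surf n) (cap p q) (fun x => v.1 x - v.2 x) ^ 2
          / (meshSize p.1 + meshSize q.1))
        * √(l2Norm (surf n) (cap p q) (fun x => w.1 x - w.2 x) ^ 2
          / (meshSize p.1 + meshSize q.1))) := by
        rw [penaltyTerm]
        refine (Finset.abs_sum_le_sum_abs _ _).trans (Finset.sum_le_sum fun p hp => ?_)
        exact (Finset.abs_sum_le_sum_abs _ _).trans (Finset.sum_le_sum fun q hq => hpair p hp q hq)
    _ ≤ _ := by
        simp only [← Finset.mul_sum]
        refine mul_le_mul_of_nonneg_left ?_ hγ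
        exact sum_sqrt_mul_sqrt_le
          (fun p _ q _ => div_nonneg (sq_nonneg _)
            (add_nonneg (meshSize_nonneg _) (meshSize_nonneg _)))
          (fun p _ q _ => div_nonneg (sq_nonneg _)
            (add_nonneg (meshSize_nonneg _) (meshSize_nonneg _)))

end HybridMesh

/-! ### Boundedness and coercivity -/

namespace HybridMesh

variable {M : HybridMesh n}

/-- The bulk part of the bilinear form. -/
def bulkTerm (M : HybridMesh n) (b : Pt n → (Pt n →L[ℝ] Pt n))
    (v w : (Pt n → ℝ) × (Pt n → ℝ)) : ℝ :=
  (∫ x in M.K₁, inner ℝ (b x (gradient v.1 x)) (gradient w.1 x))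
    + ∫ x in M.K₂, inner ℝ (b x (gradient v.2 x)) (gradient w.2 x)

theorem K₁_ae_le (M : HybridMesh n) : M.Th.space ≤ᵐ[volume] M.D :=
  space_ae_le M.finite_Th M.pure_Th fun s hs => M.interior_subset s (Or.inl hs)

theorem K₂_ae_le (M : HybridMesh n) : M.TH.space ≤ᵐ[volume] M.D :=
  space_ae_le M.finite_TH M.pure_TH fun s hs => M.interior_subset s (Or.inr hs)

theorem memLp_gradient {r : ℕ} {v : (Pt n → ℝ) × (Pt n → ℝ)}
    (hv : v ∈ FESpace r M.Th ×ˢ FESpace r M.TH) :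
    MemLp (gradient v.1) 2 (volume.restrict M.K₁) ∧
      MemLp (gradient v.2) 2 (volume.restrict M.K₂) := by
  obtain ⟨P₁, hP₁⟩ := exists_isPieces hv.1
  obtain ⟨P₂, hP₂⟩ := exists_isPieces hv.2
  exact ⟨hP₁.memLp_gradient M.finite_Th M.pure_Th, hP₂.memLp_gradient M.finite_TH M.pure_TH⟩

theorem sqrt_mul_add_sqrt_mul_le {a b c d : ℝ} (ha : 0 ≤ a) (hb : 0 ≤ b) (hc : 0 ≤ c)
    (hd : 0 ≤ d) : √a * √c + √b * √d ≤ √(a + b) * √(c + d) := by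
  rw [← Real.sqrt_mul (add_nonneg ha hb)]
  refine Real.le_sqrt_of_sq_le ?_
  have ea := Real.sq_sqrt ha
  have eb := Real.sq_sqrt hb
  have ec := Real.sq_sqrt hc
  have ed := Real.sq_sqrt hd
  set x := √a
  set y := √b
  set z := √c
  set t := √d
  rw [← ea, ← eb, ← ec, ← ed]
  nlinarith [sq_nonneg (x * t - y * z)]

theorem abs_bulkTerm_le {r : ℕ} (hLam : 0 < Lam) {b : Pt n → (Pt n →L[ℝ] Pt n)}
    (hb : b ∈ CoeffClass lam Lam M.D) {v w : (Pt n → ℝ) × (Pt n → ℝ)}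
    (hv : v ∈ FESpace r M.Th ×ˢ FESpace r M.TH) (hw : w ∈ FESpace r M.Th ×ˢ FESpace r M.TH) :
    |M.bulkTerm b v w| ≤ Lam * (√(M.gradSq v) * √(M.gradSq w)) := by
  have h₁ := abs_integral_inner_le hLam (ae_mem_coeffSet hb M.K₁_ae_le) (memLp_gradient hv).1
    (memLp_gradient hw).1
  have h₂ := abs_integral_inner_le hLam (ae_mem_coeffSet hb M.K₂_ae_le) (memLp_gradient hv).2
    (memLp_gradient hw).2
  refine (abs_add_le _ _).trans ((add_le_add h₁ h₂).trans ?_)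
  rw [← mul_add]
  refine mul_le_mul_of_nonneg_left ?_ hLam.le
  apply sqrt_mul_add_sqrt_mul_le <;> exact integral_nonneg fun _ => sq_nonneg _

theorem le_bulkTerm_self {r : ℕ} (hLam : 0 < Lam) {b : Pt n → (Pt n →L[ℝ] Pt n)}
    (hb : b ∈ CoeffClass lam Lam M.D) {v : (Pt n → ℝ) × (Pt n → ℝ)}
    (hv : v ∈ FESpace r M.Th ×ˢ FESpace r M.TH) :
    lam * M.gradSq v ≤ M.bulkTerm b v v := by
  rw [gradSq, mul_add]
  exact add_le_add
    (le_integral_inner hLam (hb.1.1.mono_measure (Measure.restrict_mono_ae M.K₁_ae_le))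
      (ae_mem_coeffSet hb M.K₁_ae_le) (memLp_gradient hv).1)
    (le_integral_inner hLam (hb.1.1.mono_measure (Measure.restrict_mono_ae M.K₂_ae_le))
      (ae_mem_coeffSet hb M.K₂_ae_le) (memLp_gradient hv).2)

/-- The origin of the threshold: with m = min(1, λ), the claim Λ√(2C²) ≤ (m/2)√γ is, after squaring,
8Λ²C² ≤ m²γ. -/
theorem mul_sqrt_le_of_penalty {C γ G J : ℝ} (hlam : 0 < lam) (hLam : 0 < Lam)
    (hγ : 8 * Lam ^ 2 * C ^ 2 / min 1 (lam ^ 2) ≤ γ) :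
    Lam * (√(2 * C ^ 2 * G) * √J) ≤ min 1 lam / 2 * (√G * √(γ * J)) := by
  have hm : 0 < min 1 lam := lt_min one_pos hlam
  have hm2 : min 1 (lam ^ 2) = min 1 lam ^ 2 := by
    rcases le_total 1 lam with h | h
    · rw [min_eq_left h, min_eq_left (one_le_pow₀ h), one_pow]
    · rw [min_eq_right h, min_eq_right (pow_le_one₀ hlam.le h)]
  rw [hm2, div_le_iff₀ (by positivity)] at hγ
  have hγ0 : 0 ≤ γ := by
    by_contra h
    push Not at h
    nlinarith [sq_nonneg (Lam * C), pow_pos hm 2]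
  have hkey : Lam * √(2 * C ^ 2) ≤ min 1 lam / 2 * √γ := by
    have h1 : Lam * √(2 * C ^ 2) = √(Lam ^ 2 * (2 * C ^ 2)) := by
      rw [Real.sqrt_mul (sq_nonneg _), Real.sqrt_sq hLam.le]
    have h2 : min 1 lam / 2 * √γ = √((min 1 lam / 2) ^ 2 * γ) := by
      rw [Real.sqrt_mul (sq_nonneg _), Real.sqrt_sq (by positivity)]
    rw [h1, h2]
    refine Real.sqrt_le_sqrt ?_
    nlinarith
  rw [Real.sqrt_mul (by positivity) G, Real.sqrt_mul hγ0 J]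
  have hp : 0 ≤ √G * √J := by positivity
  nlinarith [mul_le_mul_of_nonneg_right hkey hp]

/-- `X` and `Y` stand for the gradient and jump parts of the norm `N`. Cauchy–Schwarz in the plane
bounds both XX' + YY' and XY' + X'Y by NN'; these two groups make up the factor 2. -/
theorem form_le_of_bounds {m A L X X' Y Y' N N' : ℝ} (h1 : 1 ≤ A) (hL : L ≤ A)
    (hm1 : m ≤ 1) (hX : 0 ≤ X) (hX' : 0 ≤ X') (hY : 0 ≤ Y) (hY' : 0 ≤ Y') (hN : 0 ≤ N)
    (hN' : 0 ≤ N') (eN : N ^ 2 = X ^ 2 + Y ^ 2) (eN' : N' ^ 2 = X' ^ 2 + Y' ^ 2) :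
    L * (X * X') + m / 2 * (X * Y') + m / 2 * (X' * Y) + Y * Y' ≤ 2 * A * N * N' := by
  have hc1 : X * X' + Y * Y' ≤ N * N' := by
    refine abs_le_of_sq_le_sq' ?_ (mul_nonneg hN hN') |>.2
    rw [mul_pow, eN, eN']
    nlinarith [sq_nonneg (X * Y' - Y * X')]
  have hc2 : X * Y' + X' * Y ≤ N * N' := by
    refine abs_le_of_sq_le_sq' ?_ (mul_nonneg hN hN') |>.2
    rw [mul_pow, eN, eN']
    nlinarith [sq_nonneg (X * X' - Y * Y')]
  have hXX : L * (X * X') ≤ A * (X * X') := by gcongr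
  have hYY : Y * Y' ≤ A * (Y * Y') := le_mul_of_one_le_left (mul_nonneg hY hY') h1
  have hXY : m / 2 * (X * Y' + X' * Y) ≤ A * (X * Y' + X' * Y) := by
    gcongr
    linarith
  have hA : A * (X * X' + Y * Y') ≤ A * (N * N') := by gcongr
  have hA' : A * (X * Y' + X' * Y) ≤ A * (N * N') := by gcongr
  rw [show 2 * A * N * N' = A * (N * N') + A * (N * N') by ring]
  linarith

/-- The difference of the two sides is (l − m)X² + (1 − m)Y² + (m/2)(X − Y)². -/
theorem le_form_of_bounds {m l X Y : ℝ} (hm0 : 0 ≤ m) (hm1 : m ≤ 1) (hml : m ≤ l) :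
    m / 2 * (X ^ 2 + Y ^ 2) ≤ l * X ^ 2 - m * (X * Y) + Y ^ 2 := by
  linarith [mul_nonneg (sub_nonneg.2 hml) (sq_nonneg X),
    mul_nonneg (sub_nonneg.2 hm1) (sq_nonneg Y), mul_nonneg hm0 (sq_nonneg (X - Y))]

/-- The bilinear form of the Nitsche method is bounded and coercive in the broken norm. -/
theorem bilin_bounds (hn : 0 < n) {r : ℕ} {C : ℝ} (hC : M.IsTraceConst r C) (hlam : 0 < lam)
    (hLam : 0 < Lam) {b β₁ β₂ : Pt n → (Pt n →L[ℝ] Pt n)} (hb : b ∈ CoeffClass lam Lam M.D)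
    (hβ₁ : IsTraceOn M.K₁ M.Γ b β₁) (hβ₂ : IsTraceOn M.K₂ M.Γ b β₂) {γ : ℝ}
    (hγ : 8 * Lam ^ 2 * C ^ 2 / min 1 (lam ^ 2) ≤ γ) {v w : (Pt n → ℝ) × (Pt n → ℝ)}
    (hv : v ∈ FESpace r M.Th ×ˢ FESpace r M.TH) (hw : w ∈ FESpace r M.Th ×ˢ FESpace r M.TH) :
    |M.bilin b β₁ β₂ γ v w| ≤ 2 * max 1 Lam * M.brokenNorm γ v * M.brokenNorm γ w ∧
      min (1 / 2) (lam / 2) * M.brokenNorm γ v ^ 2 ≤ M.bilin b β₁ β₂ γ v v := by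
  have hγ0 : 0 ≤ γ := le_trans (by positivity) hγ
  have hn₁ : ∀ p ∈ M.Eh, ∀ᵐ x ∂((surf n).restrict (hull p.2)), ‖β₁ x‖ ≤ Lam := fun p hp => by
    filter_upwards [ae_trace_mem_coeffSet hLam hb M.K₁_ae_le hβ₁ (mem_Eh.1 hp)] with x hx
    exact norm_le_of_mem_coeffSet hLam hx
  have hn₂ : ∀ q ∈ M.EH, ∀ᵐ x ∂((surf n).restrict (hull q.2)), ‖β₂ x‖ ≤ Lam := fun q hq => by
    filter_upwards [ae_trace_mem_coeffSet hLam hb M.K₂_ae_le hβ₂ (mem_EH.1 hq)] with x hx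
    exact norm_le_of_mem_coeffSet hLam hx
  have hflux : ∀ {v w : (Pt n → ℝ) × (Pt n → ℝ)}, v ∈ FESpace r M.Th ×ˢ FESpace r M.TH →
      w ∈ FESpace r M.Th ×ˢ FESpace r M.TH → |M.fluxTerm β₁ β₂ v w|
        ≤ min 1 lam / 2 * (√(M.gradSq v) * √(γ * M.jumpSq w)) := fun hv hw =>
    (abs_fluxTerm_le hn hC hLam.le hn₁ hn₂ hv hw).trans
      (mul_sqrt_le_of_penalty hlam hLam hγ)
  have hflux' : ∀ {v w : (Pt n → ℝ) × (Pt n → ℝ)}, v ∈ FESpace r M.Th ×ˢ FESpace r M.TH →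
      w ∈ FESpace r M.Th ×ˢ FESpace r M.TH →
      |M.fluxTerm (fun x => (β₁ x).adjoint) (fun x => (β₂ x).adjoint) v w|
        ≤ min 1 lam / 2 * (√(M.gradSq v) * √(γ * M.jumpSq w)) := fun hv hw =>
    (abs_fluxTerm_le hn hC hLam.le
      -- Taking adjoints preserves the operator norm.
      (fun p hp => (hn₁ p hp).mono fun x hx => by rwa [LinearIsometryEquiv.norm_map])
      (fun q hq => (hn₂ q hq).mono fun x hx => by rwa [LinearIsometryEquiv.norm_map]) hv hw).trans
      (mul_sqrt_le_of_penalty hlam hLam hγ)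
  have hbilin : ∀ v w, M.bilin b β₁ β₂ γ v w = M.bulkTerm b v w - M.fluxTerm β₁ β₂ v w
      - M.fluxTerm (fun x => (β₁ x).adjoint) (fun x => (β₂ x).adjoint) w v
      + M.penaltyTerm γ v w := fun _ _ => rfl
  have hNv := brokenNorm_sq (M := M) hγ0 v
  have hNw := brokenNorm_sq (M := M) hγ0 w
  have hm0 : 0 < min 1 lam := lt_min one_pos hlam
  have hm1 : min 1 lam ≤ 1 := min_le_left _ _
  have hml : min 1 lam ≤ lam := min_le_right _ _
  have eX := Real.sq_sqrt (gradSq_nonneg (M := M) v)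
  have eX' := Real.sq_sqrt (gradSq_nonneg (M := M) w)
  have eY := Real.sq_sqrt (mul_nonneg hγ0 (jumpSq_nonneg (M := M) v))
  have eY' := Real.sq_sqrt (mul_nonneg hγ0 (jumpSq_nonneg (M := M) w))
  have f1 := hflux hv hw
  have f2 := hflux' hw hv
  have f3 := hflux hv hv
  have f4 := hflux' hv hv
  have k1 := abs_bulkTerm_le hLam hb hv hw
  have k2 := le_bulkTerm_self hLam hb hv
  have p1 : |M.penaltyTerm γ v w| ≤ √(γ * M.jumpSq v) * √(γ * M.jumpSq w) := by
    refine (abs_penaltyTerm_le hn hγ0 hv hw).trans (le_of_eq ?_)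
    rw [Real.sqrt_mul hγ0, Real.sqrt_mul hγ0]
    have := Real.mul_self_sqrt hγ0
    linear_combination (-(√(M.jumpSq v) * √(M.jumpSq w))) * this
  have p2 := penaltyTerm_self (M := M) γ v
  have hX0 := Real.sqrt_nonneg (M.gradSq v)
  have hX0' := Real.sqrt_nonneg (M.gradSq w)
  have hY0 := Real.sqrt_nonneg (γ * M.jumpSq v)
  have hY0' := Real.sqrt_nonneg (γ * M.jumpSq w)
  have hN0 : 0 ≤ M.brokenNorm γ v := Real.sqrt_nonneg _
  have hN0' : 0 ≤ M.brokenNorm γ w := Real.sqrt_nonneg _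
  rw [← eX, ← eY] at hNv
  rw [← eX', ← eY'] at hNw
  rw [← eX] at k2
  rw [← eY] at p2
  refine ⟨?_, ?_⟩
  · rw [hbilin]
    have htri : |M.bulkTerm b v w - M.fluxTerm β₁ β₂ v w
        - M.fluxTerm (fun x => (β₁ x).adjoint) (fun x => (β₂ x).adjoint) w v
        + M.penaltyTerm γ v w| ≤ |M.bulkTerm b v w| + |M.fluxTerm β₁ β₂ v w|
        + |M.fluxTerm (fun x => (β₁ x).adjoint) (fun x => (β₂ x).adjoint) w v|
        + |M.penaltyTerm γ v w| :=
      (abs_add_le _ _).trans (by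
        gcongr
        exact (abs_sub _ _).trans (by gcongr; exact abs_sub _ _))
    refine htri.trans (le_trans ?_ (form_le_of_bounds (le_max_left 1 Lam) (le_max_right 1 Lam)
      hm1 hX0 hX0' hY0 hY0' hN0 hN0' hNv hNw))
    linarith
  · have hmin : min (1 / 2) (lam / 2) = min 1 lam / 2 := by
      rw [← min_div_div_right (by norm_num : (0 : ℝ) ≤ 2)]
    rw [hmin, hbilin, hNv, p2]
    refine (le_form_of_bounds hm0.le hm1 hml).trans ?_
    -- For w = v each of the two flux terms takes away at most (m/2)XY, together the mXY of the
    -- quadratic form.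
    linarith [(abs_le.1 f3).2, (abs_le.1 f4).2]

end HybridMesh

end NitscheHybrid

end

/-! ### The two statements together -/

open NitscheHybrid in
theorem lemma3p1 (n : ℕ) (hn : 2 ≤ n) (r : ℕ) :
    (∀ σ : ℝ, ∃ C : ℝ, 0 < C ∧ ∀ M : HybridMesh n, M.ShapeRegular σ →
      M.IsTraceConst r C ∧
      ∀ s ∈ M.allElements, ∀ e ⊆ frontier (hull s), MeasurableSet e → TraceIneq r C s e) ∧
    (∀ M : HybridMesh n, ∀ Cinv : ℝ, M.IsTraceConst r Cinv →
      ∀ lam Lam : ℝ, 0 < lam → 0 < Lam →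
      ∀ b β₁ β₂ : Pt n → (Pt n →L[ℝ] Pt n), b ∈ CoeffClass lam Lam M.D →
      IsTraceOn M.K₁ M.Γ b β₁ → IsTraceOn M.K₂ M.Γ b β₂ →
      ∀ γ : ℝ, 8 * Lam ^ 2 * Cinv ^ 2 / min 1 (lam ^ 2) ≤ γ →
      ∀ v w : (Pt n → ℝ) × (Pt n → ℝ),
        v ∈ FESpace r M.Th ×ˢ FESpace r M.TH → w ∈ FESpace r M.Th ×ˢ FESpace r M.TH →
        |M.bilin b β₁ β₂ γ v w| ≤ 2 * max 1 Lam * M.brokenNorm γ v * M.brokenNorm γ w ∧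
        min (1 / 2) (lam / 2) * M.brokenNorm γ v ^ 2 ≤ M.bilin b β₁ β₂ γ v v) := by
  refine ⟨fun σ => ?_, ?_⟩
  · obtain ⟨C, hC, h⟩ := exists_isTraceConst hn r σ
    exact ⟨C, hC, fun M hM => ⟨(h M hM).1, fun s hs e he _ => (h M hM).2 s hs e he⟩⟩
  · intro M Cinv hC lam Lam hlam hLam b β₁ β₂ hb hβ₁ hβ₂ γ hγ v w hv hw
    exact HybridMesh.bilin_bounds (by omega) hC hlam hLam hb hβ₁ hβ₂ hγ hv hw
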